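/- **Graphs.** A graph $G$ consists of finite sets $A_G$ (arcs), $D_G$, $V_G$ (vertices), a fixpoint-free involution $\dagger$ on $A_G$, an injection $D_G\hookrightarrow A_G$ (regarded as an inclusion), a function $t\colon D_G\to V_G$, and a boundary $\eth(G)\subseteq A_G$ such that $D_G^\dagger\setminus D_G\subseteq\eth(G)\subseteq A_G\setminus D_G$ and $\eth(G)\setminus D_G^\dagger$ is $\dagger$-closed. It is *ordinary* if $\eth(G)=A_G\setminus D_G$, and a *nodeless loop* if it has two arcs, no vertices and empty boundary. It is *connected* if for every splitting of $A_G\leftarrow D_G\to V_G$ (with $\dagger$) as a coproduct of two such diagrams exactly one of the two is empty. The *edge* ${\updownarrow}$ has two arcs, $V=D=\varnothing$ and $\eth=A$. Put $\mathrm{nbhd}(v)=t^{-1}(v)$. An *étale map* is a natural transformation of the diagrams such that the square of $t$'s is a pullback and arcs outside $\eth\cup D$ go to arcs outside $\eth\cup D$ (a void condition between ordinary graphs); an *embedding* is an étale map between connected graphs that is injective on vertices. $\operatorname{Emb}(G)$ is the set of isomorphism classes of embeddings $f\colon H\rightarrowtail G$ with codomain $G$, with $[h]\le[k]$ if $h$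 factors through $k$; put $\varsigma[f]=f(V_H)$ and $\eth[f]=f(\eth(H))$, regarded also as elements of the free commutative monoids $\mathbb{N}V_G$ and $\mathbb{N}A_G$. The class $[f]$ *is an edge* if $H\cong{\updownarrow}$. Each vertex $v$ gives an embedding $\iota_v\colon\medstar_v\rightarrowtail G$ of its star. The class $[\ell]$ is *a union* of $[h],[k]$ if $[h],[k]\le[\ell]$ and $\varsigma[\ell]=\varsigma[h]\cup\varsigma[k]$; $[h],[k]$ are *vertex disjoint* if $\varsigma[h]\cap\varsigma[k]=\varnothing$. **Two settings.** Either "graph" means connected ordinary graph throughout (the case of $\mathbf U$), or it means connected graph, nodeless loops included (the case of $\widetilde{\mathbf U}$). **Graphical maps.** A graphical map $\varphi\colon G\to G'$ is a pair $(\varphi_0,\varphi_1)$ of an involutive function $\varphi_0\colon A_G\to A_{G'}$ and a function $\varphi_1\colon V_G\to\operatorname{Emb}(G')$ such that (i) $\sum_{v}\varsigma(\varphi_1(v))\le\sum_{w\in V_{G'}}w$ in $\mathbb{N}V_{G'}$; (ii) for each $v$, the function $d\mapsto\varphi_0(d^\dagger)$ is a bijection $\mathrm{nbhd}(v)\to\eth(\varphi_1(v))$;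 (iii) for $\mathbf U$: if $\eth(G)=\varnothing$, then some $\varphi_1(v)$ is not an edge; for $\widetilde{\mathbf U}$: if $\eth(G)=\varnothing$ and all $\varphi_1(v)$ are edges, then $G'$ is a nodeless loop. It is *active* if $\varphi_0$ restricts to a bijection $\eth(G)\to\eth(G')$. For embeddings $f\colon H\rightarrowtail G$, $g\colon K\rightarrowtail G'$ and an active $\alpha\colon H\to K$, the equation $\varphi\circ f=g\circ\alpha$ means $\varphi_0f=g\alpha_0$ on arcs and $\varphi_1(f(w))=g_*(\alpha_1(w))$ for $w\in V_H$, where $g_*[k]=[g\circ k]$; it is called an active-inert factorization of $\varphi\circ f$. The identity is $(\mathrm{id},v\mapsto[\iota_v])$. The composite $\psi\circ\varphi$ has $(\psi\circ\varphi)_0=\psi_0\varphi_0$, and $(\psi\circ\varphi)_1(v)$ is the class of the embedding in an active-inert factorization of $\psi\circ\varphi_v$, where $\varphi_v$ represents $\varphi_1(v)$. **New graph maps.** A new graph map $G\to G'$ is a pair $(\varphi_0,\hat\varphi)$ of an involutive function $\varphi_0\colon A_G\to A_{G'}$ and a function $\hat\varphi\colon\operatorname{Emb}(G)\to\operatorname{Emb}(G')$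 that sends edges to edges, preserves unions (if $[\ell]$ is a union of $[h],[k]$, then $\hat\varphi[\ell]$ is a union of $\hat\varphi[h],\hat\varphi[k]$), sends vertex disjoint pairs to vertex disjoint pairs, and satisfies $\eth\circ\hat\varphi=\mathbb{N}\varphi_0\circ\eth$ as functions $\operatorname{Emb}(G)\to\mathbb{N}A_{G'}$. Identities and composition are those of pairs of functions. **Theorem A.** In each of the two settings, graphs and graphical maps form a category ($\mathbf U$, respectively $\widetilde{\mathbf U}$) with the above identities and with the above, uniquely determined, composition. For all $G,G'$ there is a bijection from graphical maps $G\to G'$ to new graph maps $G\to G'$ which sends $(\varphi_0,\varphi_1)$ to $(\varphi_0,\hat\varphi)$, where $\hat\varphi[f]$ is the class of the embedding in any active-inert factorization of $\varphi\circ f$ (such a factorization exists, and this class does not depend on choices), and whose inverse sends $(\varphi_0,\hat\varphi)$ to $(\varphi_0,\ v\mapsto\hat\varphi[\iota_v])$. These bijections preserve identities and composition, so they form an isomorphism, identity on objects, from $\mathbf U$ (respectively $\widetilde{\mathbf U}$) to the category of graphs and new graph maps. -/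

import Mathlib

namespace ModularGraph

universe u v w

/-- A finite graph with loose ends: arcs `A` with a fixpoint-free involution `inv`, darts `D`
(half-edges attached to a vertex) with a monomorphism `s : D → A`, vertices `V` with `t : D → V`,
and a specified boundary `bd`, subject to `D† \ D ⊆ bd ⊆ A \ D` and `bd \ D†` being `†`-closed.
This is the extended notion that allows nodeless loops; see `FeynmanGraph.IsOrdinary`. -/
structure FeynmanGraph where
  A : Type u
  D : Type u
  V : Type u
  finA : Finite A
  finD : Finite D
  finV : Finite V
  inv : A → A
  inv_inv : ∀ a, inv (inv a) = a
  inv_ne : ∀ a, inv a ≠ a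
  s : D → A
  s_injective : Function.Injective s
  t : D → V
  bd : Set A
  le_bd : (inv '' Set.range s) \ Set.range s ⊆ bd
  bd_le : bd ⊆ (Set.range s)ᶜ
  bd_closed : ∀ a ∈ bd \ (inv '' Set.range s), inv a ∈ bd \ (inv '' Set.range s)

attribute [instance] FeynmanGraph.finA FeynmanGraph.finD FeynmanGraph.finV

namespace FeynmanGraph

/-- The ordinary graphs: the boundary consists of all arcs outside of `D`. -/
def IsOrdinary (G : FeynmanGraph.{u}) : Prop := G.bd = (Set.range G.s)ᶜ

/-- The neighbourhood of a vertex. -/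
def nbhd (G : FeynmanGraph.{u}) (v : G.V) : Set G.D := {d | G.t d = v}

/-- The arcs which are neither darts nor in the boundary (the arcs of nodeless loops). -/
def loopArcs (G : FeynmanGraph.{u}) : Set G.A := (G.bd ∪ Set.range G.s)ᶜ

/-- Connectedness: for each splitting of the diagram `(A, D, V)` as a coproduct of two
subdiagrams, precisely one of the two summands is empty. A splitting is determined by the arcs
`SA` and the vertices `SV` of the first summand. -/
def Connected (G : FeynmanGraph.{u}) : Prop :=
  (Nonempty G.A ∨ Nonempty G.V) ∧
    ∀ (SA : Set G.A) (SV : Set G.V),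
      (∀ a, G.inv a ∈ SA ↔ a ∈ SA) → (∀ d, G.s d ∈ SA ↔ G.t d ∈ SV) →
        (SA = ∅ ∧ SV = ∅) ∨ (SA = Set.univ ∧ SV = Set.univ)

/-- A nodeless loop has two arcs, no vertices and empty boundary. -/
def IsNodelessLoop (G : FeynmanGraph.{u}) : Prop :=
  Nat.card G.A = 2 ∧ IsEmpty G.V ∧ G.bd = ∅

end FeynmanGraph

/-- Étale maps: natural transformations for which the square of `t : D → V` is a pullback, and
which send arcs of nodeless loops to arcs of nodeless loops (no condition for ordinary graphs). -/
@[ext]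
structure EtaleMap (H G : FeynmanGraph.{u}) where
  arc : H.A → G.A
  dart : H.D → G.D
  vert : H.V → G.V
  arc_inv : ∀ a, arc (H.inv a) = G.inv (arc a)
  arc_s : ∀ d, arc (H.s d) = G.s (dart d)
  vert_t : ∀ d, vert (H.t d) = G.t (dart d)
  pullback : ∀ (e : G.D) (w : H.V), G.t e = vert w → ∃! d : H.D, dart d = e ∧ H.t d = w
  arc_loop : ∀ a ∈ H.loopArcs, arc a ∈ G.loopArcs

namespace EtaleMap

/-- The identity. -/
def id (G : FeynmanGraph.{u}) : EtaleMap G G where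
  arc a := a
  dart d := d
  vert v := v
  arc_inv _ := rfl
  arc_s _ := rfl
  vert_t _ := rfl
  pullback e _ h := ⟨e, ⟨rfl, h⟩, fun _ hd => hd.1⟩
  arc_loop _ h := h

/-- Composition, in diagrammatic order. -/
def comp {K H G : FeynmanGraph.{u}} (f : EtaleMap K H) (g : EtaleMap H G) : EtaleMap K G where
  arc a := g.arc (f.arc a)
  dart d := g.dart (f.dart d)
  vert v := g.vert (f.vert v)
  arc_inv a := by rw [f.arc_inv, g.arc_inv]
  arc_s d := by rw [f.arc_s, g.arc_s]
  vert_t d := by rw [f.vert_t, g.vert_t]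
  pullback e w h := by
    obtain ⟨d, ⟨hd, hdt⟩, hu⟩ := g.pullback e (f.vert w) h
    obtain ⟨c, ⟨hc, hct⟩, hv⟩ := f.pullback d w hdt
    refine ⟨c, ⟨by rw [hc, hd], hct⟩, ?_⟩
    rintro y ⟨hy, hyt⟩
    exact hv y ⟨hu _ ⟨hy, by rw [← f.vert_t, hyt]⟩, hyt⟩
  arc_loop a h := g.arc_loop _ (f.arc_loop a h)

/-- Isomorphisms are the invertible étale maps. -/
def IsIso {H G : FeynmanGraph.{u}} (f : EtaleMap H G) : Prop :=
  ∃ g : EtaleMap G H, f.comp g = EtaleMap.id H ∧ g.comp f = EtaleMap.id G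

theorem image_bd_subset {H G : FeynmanGraph.{u}} (f : EtaleMap H G) (g : EtaleMap G H)
    (hfg : f.comp g = EtaleMap.id H) : f.arc '' H.bd ⊆ G.bd := by
  have key : ∀ a, g.arc (f.arc a) = a := fun a => congrFun (congrArg EtaleMap.arc hfg) a
  rintro _ ⟨a, ha, rfl⟩
  by_contra hb
  by_cases hr : f.arc a ∈ Set.range G.s
  · obtain ⟨d, hd⟩ := hr
    refine H.bd_le ha ⟨g.dart d, ?_⟩
    rw [← g.arc_s, hd, key]
  · have hl := g.arc_loop (f.arc a) (by
      rintro (h | h)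
      · exact hb h
      · exact hr h)
    rw [key] at hl
    exact hl (Or.inl ha)

theorem image_bd_of_inverse {H G : FeynmanGraph.{u}} (f : EtaleMap H G) (g : EtaleMap G H)
    (hfg : f.comp g = EtaleMap.id H) (hgf : g.comp f = EtaleMap.id G) :
    f.arc '' H.bd = G.bd := by
  refine Set.Subset.antisymm (image_bd_subset f g hfg) fun b hb => ?_
  exact ⟨g.arc b, image_bd_subset g f hgf ⟨b, hb, rfl⟩,
    congrFun (congrArg EtaleMap.arc hgf) b⟩

end EtaleMap

/-- The two flavours of graphs: without or with nodeless loops. -/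
inductive Flavor
  | ordinary
  | extended

/-- Connected graphs. For `Flavor.ordinary` these are connected graphs in the basic sense; for
`Flavor.extended` these are all connected graphs, including the nodeless loops. -/
structure ConnGraph (F : Flavor) extends FeynmanGraph.{u} where
  connected : toFeynmanGraph.Connected
  isOrdinary : F = Flavor.ordinary → toFeynmanGraph.IsOrdinary

variable {F : Flavor}

/-- The edge `↕`: two arcs, both in the boundary, and no darts and vertices. -/
def edgeGraph (F : Flavor) : ConnGraph.{u} F where
  A := ULift Bool
  D := PEmpty
  V := PEmpty
  finA := inferInstance
  finD := inferInstance
  finV := inferInstance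
  inv a := ⟨!a.down⟩
  inv_inv a := by simp
  inv_ne := by rintro ⟨_ | _⟩ h <;> simp at h
  s := PEmpty.elim
  s_injective a := a.elim
  t := PEmpty.elim
  bd := Set.univ
  le_bd := Set.subset_univ _
  bd_le a _ := by rintro ⟨d, _⟩; exact d.elim
  bd_closed a _ := ⟨trivial, by rintro ⟨_, ⟨d, _⟩, _⟩; exact d.elim⟩
  connected := by
    refine ⟨Or.inl ⟨⟨true⟩⟩, fun SA SV hA _ => ?_⟩
    have hV : ∀ T : Set PEmpty, SV = T := fun T => Set.ext fun x => x.elim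
    have ht := hA ⟨true⟩
    simp only [Bool.not_true] at ht
    by_cases h : (⟨true⟩ : ULift Bool) ∈ SA
    · refine Or.inr ⟨Set.eq_univ_of_forall ?_, hV _⟩
      rintro ⟨_ | _⟩
      · exact ht.2 h
      · exact h
    · refine Or.inl ⟨Set.eq_empty_of_forall_notMem ?_, hV _⟩
      rintro ⟨_ | _⟩
      · exact fun h2 => h (ht.1 h2)
      · exact h
  isOrdinary _ := by
    refine (Set.eq_univ_of_forall fun a => ?_).symm
    rintro ⟨d, _⟩
    exact d.elim

/-- The star `⋆_v` of a vertex: one vertex, darts `nbhd v`, arcs `d` (left summand) and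
`d†` (right summand) for each `d` in `nbhd v`, and boundary consisting of all `d†`. -/
def starGraph (G : ConnGraph.{u} F) (v : G.V) : ConnGraph.{u} F where
  A := G.nbhd v ⊕ G.nbhd v
  D := G.nbhd v
  V := PUnit
  finA := inferInstance
  finD := inferInstance
  finV := inferInstance
  inv := Sum.swap
  inv_inv a := by simp
  inv_ne := by rintro (a | a) h <;> simp at h
  s := Sum.inl
  s_injective := Sum.inl_injective
  t _ := PUnit.unit
  bd := Set.range Sum.inr
  le_bd := by
    rintro (a | a) ⟨_, h⟩
    · exact absurd ⟨a, rfl⟩ h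
    · exact ⟨a, rfl⟩
  bd_le := by
    rintro _ ⟨a, rfl⟩ ⟨b, h⟩
    simp at h
  bd_closed := by
    rintro _ ⟨⟨a, rfl⟩, h⟩
    exact absurd ⟨Sum.inl a, ⟨a, rfl⟩, rfl⟩ h
  connected := by
    refine ⟨Or.inr ⟨PUnit.unit⟩, fun SA SV hA hD => ?_⟩
    by_cases h : PUnit.unit ∈ SV
    · have hl : ∀ d, Sum.inl d ∈ SA := fun d => (hD d).2 h
      refine Or.inr ⟨Set.eq_univ_of_forall ?_, Set.eq_univ_of_forall fun _ => h⟩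
      rintro (d | d)
      · exact hl d
      · exact (hA (Sum.inr d)).1 (hl d)
    · have hl : ∀ d, Sum.inl d ∉ SA := fun d hd => h ((hD d).1 hd)
      refine Or.inl ⟨Set.eq_empty_of_forall_notMem ?_,
        Set.eq_empty_of_forall_notMem fun _ => h⟩
      rintro (d | d) hd
      · exact hl d hd
      · exact hl d ((hA (Sum.inr d)).2 hd)
  isOrdinary _ := by
    ext (a | a) <;> simp

/-- Embeddings of connected graphs: étale maps which are injective on vertices. -/
@[ext]
structure GraphEmbedding (H G : ConnGraph.{u} F) extends
    EtaleMap H.toFeynmanGraph G.toFeynmanGraph where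
  vert_injective : Function.Injective vert

namespace GraphEmbedding

/-- The identity embedding. -/
def id (G : ConnGraph.{u} F) : GraphEmbedding G G where
  toEtaleMap := EtaleMap.id _
  vert_injective _ _ h := h

/-- Composition of embeddings, in diagrammatic order. -/
def comp {K H G : ConnGraph.{u} F} (f : GraphEmbedding K H) (g : GraphEmbedding H G) :
    GraphEmbedding K G where
  toEtaleMap := f.toEtaleMap.comp g.toEtaleMap
  vert_injective := g.vert_injective.comp f.vert_injective

/-- The embedding `ι_v : ⋆_v → G` of the star of a vertex. -/
def star (G : ConnGraph.{u} F) (v : G.V) : GraphEmbedding (starGraph G v) G where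
  arc := Sum.elim (fun d => G.s d.1) (fun d => G.inv (G.s d.1))
  dart d := d.1
  vert _ := v
  arc_inv := by
    rintro (d | d)
    · rfl
    · exact (G.inv_inv _).symm
  arc_s _ := rfl
  vert_t d := d.2.symm
  pullback e w h := ⟨⟨e, h⟩, ⟨rfl, rfl⟩, fun y hy => Subtype.ext hy.1⟩
  arc_loop := by
    rintro (a | a) h
    · exact absurd (Or.inr ⟨a, rfl⟩) h
    · exact absurd (Or.inl ⟨a, rfl⟩) h
  vert_injective _ _ _ := rfl

end GraphEmbedding

/-- Isomorphism of embeddings into `G`: `f ~ h` when `f = h ∘ z` for an isomorphism `z`. -/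
instance embSetoid (G : ConnGraph.{u} F) :
    Setoid (Σ H : ConnGraph.{u} F, GraphEmbedding H G) where
  r x y := ∃ z : EtaleMap x.1.toFeynmanGraph y.1.toFeynmanGraph,
    z.IsIso ∧ z.comp y.2.toEtaleMap = x.2.toEtaleMap
  iseqv :=
    { refl := fun x => ⟨EtaleMap.id _, ⟨EtaleMap.id _, rfl, rfl⟩, rfl⟩
      symm := by
        rintro x y ⟨z, ⟨z2, h1, h2⟩, h⟩
        refine ⟨z2, ⟨z, h2, h1⟩, ?_⟩
        rw [← h]
        change (z2.comp z).comp y.2.toEtaleMap = _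
        rw [h2]
        rfl
      trans := by
        rintro x y z ⟨f, ⟨f2, h1, h2⟩, h⟩ ⟨g, ⟨g2, k1, k2⟩, k⟩
        refine ⟨f.comp g, ⟨g2.comp f2, ?_, ?_⟩, ?_⟩
        · change f.comp ((g.comp g2).comp f2) = _
          rw [k1]
          exact h1
        · change g2.comp ((f2.comp f).comp g) = _
          rw [h2]
          exact k2
        · change f.comp (g.comp z.2.toEtaleMap) = _
          rw [k, h] }

/-- The set `Emb(G)` of isomorphism classes of embeddings with codomain `G`. -/
def Emb (G : ConnGraph.{u} F) : Type (u + 1) := Quotient (embSetoid G)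

namespace Emb

variable {G : ConnGraph.{u} F}

/-- The class `[f]` of an embedding. -/
def mk {H : ConnGraph.{u} F} (f : GraphEmbedding H G) : Emb G := Quotient.mk _ ⟨H, f⟩

/-- `[h] ≤ [k]` when `h` factors through `k`. -/
instance : LE (Emb G) where
  le := Quotient.lift₂
    (fun x y => ∃ z : EtaleMap x.1.toFeynmanGraph y.1.toFeynmanGraph,
      z.comp y.2.toEtaleMap = x.2.toEtaleMap)
    (by
      have aux : ∀ x y x2 y2 : Σ H : ConnGraph.{u} F, GraphEmbedding H G, x ≈ x2 → y ≈ y2 →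
          (∃ z : EtaleMap x.1.toFeynmanGraph y.1.toFeynmanGraph,
            z.comp y.2.toEtaleMap = x.2.toEtaleMap) →
          ∃ z : EtaleMap x2.1.toFeynmanGraph y2.1.toFeynmanGraph,
            z.comp y2.2.toEtaleMap = x2.2.toEtaleMap := by
        intro x y x2 y2 hx hy
        obtain ⟨f, _, hf⟩ := Setoid.symm hx
        obtain ⟨g, _, hg⟩ := hy
        rintro ⟨z, hz⟩
        refine ⟨(f.comp z).comp g, ?_⟩
        change f.comp (z.comp (g.comp y2.2.toEtaleMap)) = _
        rw [hg, hz, hf]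
      intro x y x2 y2 hx hy
      exact propext ⟨aux _ _ _ _ hx hy, aux _ _ _ _ (Setoid.symm hx) (Setoid.symm hy)⟩)

/-- The set `f(V_H)` of vertices in the image of `[f : H → G]`. -/
def verts : Emb G → Set G.V :=
  Quotient.lift (fun x => Set.range x.2.vert) (by
    rintro x y ⟨z, ⟨z2, h1, h2⟩, h⟩
    have e1 : ∀ a, y.2.vert (z.vert a) = x.2.vert a :=
      fun a => congrFun (congrArg EtaleMap.vert h) a
    have e2 : ∀ b, z.vert (z2.vert b) = b :=
      fun b => congrFun (congrArg EtaleMap.vert h2) b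
    ext c
    constructor
    · rintro ⟨a, rfl⟩
      exact ⟨z.vert a, e1 a⟩
    · rintro ⟨b, rfl⟩
      exact ⟨z2.vert b, by rw [← e1, e2]⟩)

/-- The boundary `f(∂H)` of `[f : H → G]`. -/
def boundary : Emb G → Set G.A :=
  Quotient.lift (fun x => x.2.arc '' x.1.bd) (by
    rintro x y ⟨z, ⟨z2, h1, h2⟩, h⟩
    have e1 : ∀ a, y.2.arc (z.arc a) = x.2.arc a :=
      fun a => congrFun (congrArg EtaleMap.arc h) a
    change x.2.arc '' x.1.bd = y.2.arc '' y.1.bd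
    rw [← EtaleMap.image_bd_of_inverse z z2 h1 h2, Set.image_image]
    simp only [e1])

/-- `[f : H → G]` is an edge when `H` is isomorphic to `↕`. -/
def IsEdge (x : Emb G) : Prop :=
  ∃ (H : ConnGraph.{u} F) (f : GraphEmbedding H G), Emb.mk f = x ∧
    ∃ z : EtaleMap H.toFeynmanGraph (edgeGraph.{u} F).toFeynmanGraph, z.IsIso

/-- `l` is a union of `h` and `k`. -/
def IsUnion (l h k : Emb G) : Prop :=
  h ≤ l ∧ k ≤ l ∧ l.verts = h.verts ∪ k.verts

/-- Vertex disjointness. -/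
def VertexDisjoint (h k : Emb G) : Prop := h.verts ∩ k.verts = ∅

/-- A subset of a finite set, as an element of the free commutative monoid. -/
noncomputable def sumOf {S : Type u} [Finite S] (T : Set S) : Multiset S :=
  (Set.toFinite T).toFinset.val

/-- The vertex sum `ς : Emb(G) → ℕV_G`. -/
noncomputable def vertexSum (x : Emb G) : Multiset G.V := sumOf x.verts

/-- The boundary `∂ : Emb(G) → ℕA_G`. -/
noncomputable def boundarySum (x : Emb G) : Multiset G.A := sumOf x.boundary

/-- The function `Emb(K) → Emb(G)`, `[f] ↦ [g ∘ f]`, for an embedding `g : K → G`. -/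
def map {K : ConnGraph.{u} F} (g : GraphEmbedding K G) : Emb K → Emb G :=
  Quotient.map (fun x => ⟨x.1, x.2.comp g⟩) (by
    rintro x y ⟨z, hz, h⟩
    refine ⟨z, hz, ?_⟩
    change (z.comp y.2.toEtaleMap).comp g.toEtaleMap = _
    rw [h]
    rfl)

end Emb

/-- Graphical maps `(φ₀, φ₁)`. The collapse condition depends on whether nodeless loops are
allowed. -/
@[ext]
structure GraphicalMap (G K : ConnGraph.{u} F) where
  arc : G.A → K.A
  vert : G.V → Emb K
  arc_inv : ∀ a, arc (G.inv a) = K.inv (arc a)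
  vertexSum_le : (∑ᶠ v, (vert v).vertexSum) ≤ ∑ᶠ w : K.V, ({w} : Multiset K.V)
  boundary_vert : ∀ v, ∃ e : G.nbhd v ≃ (vert v).boundary,
    ∀ d : G.nbhd v, (e d : K.A) = arc (G.inv (G.s d.1))
  collapse : F = Flavor.ordinary → G.bd = ∅ → ∃ v, ¬ (vert v).IsEdge
  collapse_extended : F = Flavor.extended → G.bd = ∅ → (∀ v, (vert v).IsEdge) →
    K.IsNodelessLoop

namespace GraphicalMap

/-- Active maps: `φ₀` restricts to a bijection between the boundaries. -/
def IsActive {G K : ConnGraph.{u} F} (φ : GraphicalMap G K) : Prop :=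
  Set.BijOn φ.arc G.bd K.bd

/-- There is an active graphical map `α : H → L` with `φ ∘ f = g ∘ α`, where `f : H → G` and
`g : L → K` are embeddings. Here `(φ ∘ f)₁ = φ₁ ∘ f` and `(g ∘ α)₁ = g_* ∘ α₁`. -/
def HasActiveInert {G K H L : ConnGraph.{u} F} (φ : GraphicalMap G K)
    (f : GraphEmbedding H G) (g : GraphEmbedding L K) : Prop :=
  ∃ α : GraphicalMap H L, α.IsActive ∧
    (∀ a, g.arc (α.arc a) = φ.arc (f.arc a)) ∧
    ∀ v, Emb.map g (α.vert v) = φ.vert (f.vert v)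

/-- `y = [g]` for some active-inert factorization `φ ∘ f = g ∘ α`, where `x = [f]`. -/
def IsImage {G K : ConnGraph.{u} F} (φ : GraphicalMap G K) (x : Emb G) (y : Emb K) : Prop :=
  ∃ (H L : ConnGraph.{u} F) (f : GraphEmbedding H G) (g : GraphEmbedding L K),
    Emb.mk f = x ∧ Emb.mk g = y ∧ φ.HasActiveInert f g

/-- The identity graphical map: identity on arcs, and `v ↦ [ι_v]`. -/
def IsIdentity {G : ConnGraph.{u} F} (φ : GraphicalMap G G) : Prop :=
  (∀ a, φ.arc a = a) ∧ ∀ v, φ.vert v = Emb.mk (GraphEmbedding.star G v)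

/-- `χ = ψ ∘ φ`: one has `χ₀ = ψ₀ ∘ φ₀`, and if `φ₁(v) = [φ_v]` then `χ₁(v)` is the class of the
embedding in an active-inert factorization of `ψ ∘ φ_v`. -/
def IsComposite {G K L : ConnGraph.{u} F} (φ : GraphicalMap G K) (ψ : GraphicalMap K L)
    (χ : GraphicalMap G L) : Prop :=
  (∀ a, χ.arc a = ψ.arc (φ.arc a)) ∧ ∀ v, ψ.IsImage (φ.vert v) (χ.vert v)

end GraphicalMap

/-- New graph maps `(φ₀, φ̂)`. -/
@[ext]
structure NewGraphMap (G K : ConnGraph.{u} F) where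
  arc : G.A → K.A
  hat : Emb G → Emb K
  arc_inv : ∀ a, arc (G.inv a) = K.inv (arc a)
  hat_edge : ∀ x, x.IsEdge → (hat x).IsEdge
  hat_union : ∀ l h k, Emb.IsUnion l h k → Emb.IsUnion (hat l) (hat h) (hat k)
  hat_disjoint : ∀ h k, Emb.VertexDisjoint h k → Emb.VertexDisjoint (hat h) (hat k)
  hat_boundary : ∀ h, (hat h).boundarySum = Multiset.map arc h.boundarySum

/-- A category with the given objects and the given sets of morphisms (composition is written in
diagrammatic order). -/
structure HomCategory {Obj : Type v} (Hom : Obj → Obj → Type w) where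
  id : ∀ X, Hom X X
  comp : ∀ {X Y Z}, Hom X Y → Hom Y Z → Hom X Z
  id_comp : ∀ {X Y} (f : Hom X Y), comp (id X) f = f
  comp_id : ∀ {X Y} (f : Hom X Y), comp f (id Y) = f
  assoc : ∀ {W X Y Z} (f : Hom W X) (g : Hom X Y) (h : Hom Y Z),
    comp (comp f g) h = comp f (comp g h)

/-- The category of connected graphs and new graph maps: composition of pairs of functions. -/
def newGraphCategory (F : Flavor) :
    HomCategory (fun G K : ConnGraph.{u} F => NewGraphMap G K) where
  id G :=
    { arc := fun a => a
      hat := fun x => x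
      arc_inv := fun _ => rfl
      hat_edge := fun _ h => h
      hat_union := fun _ _ _ h => h
      hat_disjoint := fun _ _ h => h
      hat_boundary := fun h => (Multiset.map_id _).symm }
  comp φ ψ :=
    { arc := fun a => ψ.arc (φ.arc a)
      hat := fun x => ψ.hat (φ.hat x)
      arc_inv := fun a => by rw [φ.arc_inv, ψ.arc_inv]
      hat_edge := fun x h => ψ.hat_edge _ (φ.hat_edge x h)
      hat_union := fun l h k e => ψ.hat_union _ _ _ (φ.hat_union l h k e)
      hat_disjoint := fun h k e => ψ.hat_disjoint _ _ (φ.hat_disjoint h k e)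
      hat_boundary := fun h => by
        rw [ψ.hat_boundary, φ.hat_boundary, Multiset.map_map]
        rfl }
  id_comp _ := rfl
  comp_id _ := rfl
  assoc _ _ _ := rfl

end ModularGraph

open ModularGraph

universe u

/-! A class in `Emb G` is determined by its vertices and its boundary (`Emb.ext`). So the class of
the embedding in an active-inert factorization of φ ∘ f is unique once these two sets are known: its
boundary is the image under φ₀ of that of f, and its vertices are those of the φ₁(v) for v in f,
because an active map misses no vertex (`IsActive.exists_mem_verts`).

Existence (`exists_factorization`) is graph substitution: each vertex v is replaced by the domain of
φ₁(v). A vertex sent to an edge disappears and its two darts are joined, so an arc has to be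
followed through such vertices until the walk stops. It can fail to stop only if φ collapses G
(`exists_terminal`), and then the target is a nodeless loop.

Conversely, every class arises from edges and stars by unions (`Emb.union_induction`). Hence φ̂ is
determined by its values on stars, which fix the vertices, and by φ₀, which fixes the boundary;
`Emb.ext` then gives the bijection. Pairs of functions obviously form a category; its structure is
transported to graphical maps, and `image_star` shows that the result is the composition described
by factorizations. -/

namespace ModularGraph

variable {F : Flavor}

/-! ### Arcs and boundaries of connected graphs. -/

namespace ConnGraph

variable (G : ConnGraph.{u} F)

theorem inv_injective : Function.Injective G.inv := fun a b h => by
  rw [← G.inv_inv a, h, G.inv_inv]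

theorem s_notMem_bd (d : G.D) : G.s d ∉ G.bd := fun h => G.bd_le h ⟨d, rfl⟩

/-- The arcs touching a dart, together with all vertices, form a summand, which is everything by
connectedness. -/
theorem mem_range_or [Nonempty G.V] (a : G.A) :
    (∃ d, G.s d = a) ∨ ∃ d, G.s d = G.inv a := by
  rcases G.connected.2 {b | (∃ d, G.s d = b) ∨ ∃ d, G.s d = G.inv b} Set.univ
    (fun b => by simp only [Set.mem_ofPred_eq, G.inv_inv]; exact or_comm)
    (fun d => iff_of_true (Or.inl ⟨d, rfl⟩) trivial) with h | h
  · exact absurd h.2 Set.univ_nonempty.ne_empty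
  · exact (Set.ext_iff.1 h.1 a).2 trivial

theorem mem_bd_of_inv {a : G.A} (h : ∀ d, G.s d ≠ a) {d : G.D} (hd : G.s d = G.inv a) :
    a ∈ G.bd :=
  G.le_bd ⟨⟨G.s d, ⟨d, rfl⟩, by rw [hd, G.inv_inv]⟩, fun ⟨e, he⟩ => h e he⟩

theorem exists_s_eq_inv [Nonempty G.V] {b : G.A} (hb : b ∈ G.bd) : ∃ d, G.s d = G.inv b := by
  rcases G.mem_range_or b with ⟨d, rfl⟩ | h
  · exact absurd hb (G.s_notMem_bd d)
  · exact h

theorem notMem_loopArcs [Nonempty G.V] (a : G.A) : a ∉ G.loopArcs := by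
  intro h
  rcases G.mem_range_or a with h' | ⟨d, hd⟩
  · exact h (Or.inr h')
  · refine h (Or.inl (G.mem_bd_of_inv (fun e he => h (Or.inr ⟨e, he⟩)) hd))

theorem mem_bd_or_range [Nonempty G.V] (a : G.A) : a ∈ G.bd ∨ ∃ d, G.s d = a := by
  by_contra h
  exact G.notMem_loopArcs a fun h' => h h'

theorem isEmpty_D [IsEmpty G.V] : IsEmpty G.D := ⟨fun d => isEmptyElim (G.t d)⟩

theorem nonempty_A [IsEmpty G.V] : Nonempty G.A :=
  G.connected.1.resolve_right fun ⟨v⟩ => isEmptyElim v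

/-- An arc and its inverse form a summand when there are no vertices. So a vertexless graph is an
edge or a nodeless loop. -/
theorem eq_or_eq_inv [IsEmpty G.V] (a b : G.A) : b = a ∨ b = G.inv a := by
  have hD := G.isEmpty_D
  rcases G.connected.2 {b | b = a ∨ b = G.inv a} ∅
    (fun b => by
      constructor
      · rintro (h | h)
        · exact Or.inr (by rw [← h, G.inv_inv])
        · exact Or.inl (G.inv_injective h)
      · rintro (h | h)
        · exact Or.inr (by rw [h])
        · exact Or.inl (by rw [h, G.inv_inv]))
    (fun d => isEmptyElim d) with h | h
  · exact absurd h.1 (Set.nonempty_iff_ne_empty.1 ⟨a, Or.inl rfl⟩)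
  · exact (Set.ext_iff.1 h.1 b).2 trivial

theorem inv_mem_bd [IsEmpty G.V] {a : G.A} (h : a ∈ G.bd) : G.inv a ∈ G.bd := by
  have hD := G.isEmpty_D
  exact (G.bd_closed a ⟨h, fun ⟨_, ⟨d, _⟩, _⟩ => isEmptyElim d⟩).1

theorem bd_eq_univ [IsEmpty G.V] (h : G.bd.Nonempty) : G.bd = Set.univ := by
  obtain ⟨a, ha⟩ := h
  refine Set.eq_univ_of_forall fun b => ?_
  rcases G.eq_or_eq_inv a b with rfl | rfl
  · exact ha
  · exact G.inv_mem_bd ha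

theorem ncard_A [IsEmpty G.V] : Nat.card G.A = 2 := by
  obtain ⟨a⟩ := G.nonempty_A
  have h : (Set.univ : Set G.A) = {a, G.inv a} :=
    (Set.eq_univ_of_forall fun b => by simpa using G.eq_or_eq_inv a b).symm
  rw [← Set.ncard_univ, h, Set.ncard_pair (G.inv_ne a).symm]

theorem isNodelessLoop_of [IsEmpty G.V] (h : G.bd = ∅) : G.IsNodelessLoop :=
  ⟨G.ncard_A, inferInstance, h⟩

theorem not_ordinary_of [IsEmpty G.V] (h : G.bd = ∅) : F ≠ Flavor.ordinary := by
  intro hF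
  have hD := G.isEmpty_D
  obtain ⟨a⟩ := G.nonempty_A
  have : a ∈ G.bd := by
    rw [G.isOrdinary hF]
    exact fun ⟨d, _⟩ => isEmptyElim d
  rw [h] at this
  exact this

end ConnGraph

/-! ### Embeddings and lifts between them. -/

namespace GraphEmbedding

variable {H H' G : ConnGraph.{u} F}

theorem dart_injective (f : GraphEmbedding H G) : Function.Injective f.dart := by
  intro d e h
  have ht : H.t d = H.t e := f.vert_injective (by rw [f.vert_t, f.vert_t, h])
  exact (f.pullback (f.dart d) (H.t e) (by rw [h, f.vert_t])).unique ⟨rfl, ht⟩ ⟨h.symm, rfl⟩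

/-- An embedding may glue a boundary arc to a dart, but not to another boundary arc: if there are
vertices, inverses of boundary arcs are darts, and darts are injected. -/
theorem arc_bd_injOn (f : GraphEmbedding H G) : Set.InjOn f.arc H.bd := by
  intro a ha b hb h
  rcases isEmpty_or_nonempty H.V with hV | hV
  · rcases H.eq_or_eq_inv a b with rfl | rfl
    · rfl
    · rw [f.arc_inv] at h
      exact absurd h.symm (G.inv_ne _)
  · obtain ⟨d, hd⟩ := H.exists_s_eq_inv ha
    obtain ⟨e, he⟩ := H.exists_s_eq_inv hb
    have : d = e := f.dart_injective (G.s_injective (by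
      rw [← f.arc_s, ← f.arc_s, hd, he, f.arc_inv, f.arc_inv, h]))
    subst this
    exact H.inv_injective (hd.symm.trans he)

theorem s_eq_arc_s (f : GraphEmbedding H G) {d : H.D} {e : G.D} (h : f.arc (H.s d) = G.s e) :
    f.dart d = e := G.s_injective (by rw [← f.arc_s, h])

theorem exists_dart (f : GraphEmbedding H G) {e : G.D} {w : H.V} (h : G.t e = f.vert w) :
    ∃ d, f.dart d = e ∧ H.t d = w := (f.pullback e w h).exists

/-- An étale map from a graph with vertices is determined by its values on vertices and darts. -/
theorem _root_.ModularGraph.EtaleMap.ext_of_nonempty [Nonempty H.V]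
    {y z : EtaleMap H.toFeynmanGraph G.toFeynmanGraph}
    (hv : ∀ v, y.vert v = z.vert v) (hd : ∀ d, y.dart d = z.dart d) : y = z := by
  refine EtaleMap.ext (funext fun a => ?_) (funext hd) (funext hv)
  rcases H.mem_range_or a with ⟨d, rfl⟩ | ⟨d, h⟩
  · rw [y.arc_s, z.arc_s, hd]
  · apply G.inv_injective
    rw [← y.arc_inv, ← z.arc_inv, ← h, y.arc_s, z.arc_s, hd]

/-- Over `G`, an embedding `f` from a graph with vertices factors through `f'` when the vertices of
`f` are among those of `f'`, and when `f` cuts all its edges that are cut by `f'`. -/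
theorem exists_lift [Nonempty H.V] (f : GraphEmbedding H G) (f' : GraphEmbedding H' G)
    (hv : Set.range f.vert ⊆ Set.range f'.vert)
    (hb : ∀ d, f.arc (H.inv (H.s d)) ∈ f'.arc '' H'.bd → H.inv (H.s d) ∈ H.bd) :
    ∃ z : EtaleMap H.toFeynmanGraph H'.toFeynmanGraph, z.comp f'.toEtaleMap = f.toEtaleMap := by
  have hv' : ∀ w, ∃ w', f'.vert w' = f.vert w := fun w => hv ⟨w, rfl⟩
  choose zv hzv using hv'
  have hd' : ∀ d, ∃ d', f'.dart d' = f.dart d ∧ H'.t d' = zv (H.t d) := fun d =>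
    f'.exists_dart (by rw [hzv, f.vert_t])
  choose zd hzd hzt using hd'
  have hs : ∀ d, f'.arc (H'.s (zd d)) = f.arc (H.s d) := fun d => by
    rw [f'.arc_s, f.arc_s, hzd]
  -- Darts joined in `H` stay joined in `H'`: otherwise `f'` cuts the edge, and `hb` puts a dart of
  -- `H` into its boundary.
  have core : ∀ d e, H.s e = H.inv (H.s d) → H'.s (zd e) = H'.inv (H'.s (zd d)) := by
    intro d e h
    by_cases hr : ∃ e', H'.s e' = H'.inv (H'.s (zd d))
    · obtain ⟨e', he'⟩ := hr
      rw [← he']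
      congr 1
      apply f'.dart_injective
      rw [hzd]
      apply G.s_injective
      rw [← f'.arc_s, he', f'.arc_inv, hs, ← f.arc_inv, ← h, f.arc_s]
    · refine absurd (hb d ⟨H'.inv (H'.s (zd d)), ?_, ?_⟩) ?_
      · exact H'.mem_bd_of_inv (fun e' he' => hr ⟨e', he'⟩) (H'.inv_inv _).symm
      · rw [f'.arc_inv, hs, f.arc_inv]
      · rw [← h]
        exact H.s_notMem_bd e
  -- An arc can be both a dart and the inverse of a dart; `core` makes the two prescriptions agree.
  have ha' : ∀ a, ∃ a', (∀ d, H.s d = a → a' = H'.s (zd d)) ∧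
      ∀ d, H.s d = H.inv a → a' = H'.inv (H'.s (zd d)) := by
    intro a
    rcases H.mem_range_or a with ⟨d, rfl⟩ | ⟨d, h⟩
    · refine ⟨H'.s (zd d), fun e he => by rw [H.s_injective he], fun e he => ?_⟩
      rw [core d e he, H'.inv_inv]
    · refine ⟨H'.inv (H'.s (zd d)), fun e he => ?_, fun e he => ?_⟩
      · exact (core d e (by rw [he, h, H.inv_inv])).symm
      · rw [← h] at he
        rw [H.s_injective he]
  choose za h1 h2 using ha'
  have hvc : ∀ v, f'.vert (zv v) = f.vert v := hzv
  have hac : ∀ a, f'.arc (za a) = f.arc a := by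
    intro a
    rcases H.mem_range_or a with ⟨d, rfl⟩ | ⟨d, h⟩
    · rw [h1 _ d rfl, hs]
    · rw [h2 a d h, f'.arc_inv, hs, h, f.arc_inv, G.inv_inv]
  refine ⟨{ arc := za, dart := zd, vert := zv, arc_inv := ?_, arc_s := fun d => h1 _ d rfl,
            vert_t := fun d => (hzt d).symm, pullback := ?_, arc_loop := ?_ },
    EtaleMap.ext (funext hac) (funext hzd) (funext hvc)⟩
  · intro a
    rcases H.mem_range_or a with ⟨d, rfl⟩ | ⟨d, h⟩
    · rw [h1 _ d rfl, h2 (H.inv (H.s d)) d (H.inv_inv _).symm]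
    · rw [h2 a d h, H'.inv_inv, h1 _ d h]
  · intro e w h
    obtain ⟨d, hd, ht⟩ := f.exists_dart (e := f'.dart e) (w := w) (by
      rw [← f'.vert_t, h, hvc])
    refine ⟨d, ⟨f'.dart_injective (by rw [hzd, hd]), ht⟩, ?_⟩
    rintro c ⟨hc, _⟩
    apply f.dart_injective
    rw [hd, ← hc, hzd]
  · exact fun a ha => absurd ha (H.notMem_loopArcs a)

theorem exists_lift_of_eq [Nonempty H.V] (f : GraphEmbedding H G) (f' : GraphEmbedding H' G)
    (hv : Set.range f.vert ⊆ Set.range f'.vert) (hb : f'.arc '' H'.bd ⊆ f.arc '' H.bd) :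
    ∃ z : EtaleMap H.toFeynmanGraph H'.toFeynmanGraph, z.comp f'.toEtaleMap = f.toEtaleMap := by
  refine exists_lift f f' hv fun d hd => ?_
  obtain ⟨b, hb, h⟩ := hb hd
  obtain ⟨e, he⟩ := H.exists_s_eq_inv hb
  have : e = d := f.dart_injective (f.s_eq_arc_s (by
    rw [he, f.arc_inv, h, f.arc_inv, G.inv_inv, f.arc_s]))
  subst this
  rwa [he, H.inv_inv]

/-- An embedding of a graph with empty boundary is surjective. -/
theorem surjective_of_bd_eq_empty (f : GraphEmbedding H G) (h : H.bd = ∅) :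
    Function.Surjective f.arc ∧ Function.Surjective f.vert := by
  have hA : ∀ a, G.inv a ∈ Set.range f.arc ↔ a ∈ Set.range f.arc := by
    intro a
    constructor
    · rintro ⟨b, hb⟩
      exact ⟨H.inv b, by rw [f.arc_inv, hb, G.inv_inv]⟩
    · rintro ⟨b, rfl⟩
      exact ⟨H.inv b, f.arc_inv b⟩
  have hD : ∀ d, G.s d ∈ Set.range f.arc ↔ G.t d ∈ Set.range f.vert := by
    intro d
    constructor
    · rintro ⟨a, ha⟩
      by_cases hr : ∃ e, H.s e = a
      · obtain ⟨e, rfl⟩ := hr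
        exact ⟨H.t e, by rw [f.vert_t, f.s_eq_arc_s ha]⟩
      · have : f.arc a ∈ G.loopArcs := f.arc_loop a (by
          rintro (h' | h')
          · rw [h] at h'
            exact h'
          · exact hr h')
        exact absurd (Or.inr ⟨d, ha.symm⟩) this
    · rintro ⟨w, hw⟩
      obtain ⟨c, hc, -⟩ := f.exists_dart hw.symm
      exact ⟨H.s c, by rw [f.arc_s, hc]⟩
  -- The image of `f` is a summand, since without boundary in `H` only darts can go to darts.
  rcases G.connected.2 _ _ hA hD with ⟨h1, h2⟩ | ⟨h1, h2⟩
  · rcases H.connected.1 with ⟨⟨a⟩⟩ | ⟨⟨v⟩⟩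
    · exact absurd h1 (Set.range_nonempty_iff_nonempty.2 ⟨a⟩).ne_empty
    · exact absurd h2 (Set.range_nonempty_iff_nonempty.2 ⟨v⟩).ne_empty
  · exact ⟨Set.range_eq_univ.1 h1, Set.range_eq_univ.1 h2⟩

theorem bd_eq_empty (f : GraphEmbedding H G) (h : H.bd = ∅) : G.bd = ∅ := by
  refine Set.eq_empty_of_forall_notMem fun b hb => ?_
  obtain ⟨a, rfl⟩ := (f.surjective_of_bd_eq_empty h).1 b
  by_cases hr : ∃ e, H.s e = a
  · obtain ⟨e, rfl⟩ := hr
    rw [f.arc_s] at hb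
    exact G.s_notMem_bd _ hb
  · exact f.arc_loop a (by
      rintro (h' | h')
      · rw [h] at h'
        exact h'
      · exact hr h') (Or.inl hb)

end GraphEmbedding

namespace GraphEmbedding

variable {H H' G : ConnGraph.{u} F}

theorem arc_injective [IsEmpty H.V] (f : GraphEmbedding H G) : Function.Injective f.arc := by
  intro a b h
  rcases H.eq_or_eq_inv a b with rfl | rfl
  · rfl
  · rw [f.arc_inv] at h
    exact absurd h.symm (G.inv_ne _)

theorem exists_lift_of_isEmpty [IsEmpty H.V] [IsEmpty H'.V] (f : GraphEmbedding H G)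
    (f' : GraphEmbedding H' G) (ha : Set.range f.arc ⊆ Set.range f'.arc)
    (hb : H.bd = ∅ → H'.bd = ∅) :
    ∃ z : EtaleMap H.toFeynmanGraph H'.toFeynmanGraph, z.comp f'.toEtaleMap = f.toEtaleMap := by
  have hD := H.isEmpty_D
  have hD' := H'.isEmpty_D
  have ha' : ∀ a, ∃ a', f'.arc a' = f.arc a := fun a => ha ⟨a, rfl⟩
  choose za hza using ha'
  refine ⟨{ arc := za, dart := isEmptyElim, vert := isEmptyElim, arc_inv := fun a => ?_,
            arc_s := isEmptyElim, vert_t := isEmptyElim, pullback := isEmptyElim,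
            arc_loop := fun a h => ?_ },
    EtaleMap.ext (funext hza) (funext isEmptyElim) (funext isEmptyElim)⟩
  · apply f'.arc_injective
    rw [hza, f'.arc_inv, hza, f.arc_inv]
  · have : H.bd = ∅ := by
      rcases H.bd.eq_empty_or_nonempty with h' | h'
      · exact h'
      · exact absurd (Or.inl (by rw [H.bd_eq_univ h']; trivial)) h
    rintro (h' | ⟨d, -⟩)
    · rw [hb this] at h'
      exact h'
    · exact isEmptyElim d

/-- The embedding of the edge given by an arc. -/
def edge (G : ConnGraph.{u} F) (a : G.A) : GraphEmbedding (edgeGraph.{u} F) G where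
  arc b := bif b.down then a else G.inv a
  dart := PEmpty.elim
  vert := PEmpty.elim
  arc_inv := by
    rintro ⟨_ | _⟩
    · exact (G.inv_inv a).symm
    · rfl
  arc_s d := d.elim
  vert_t d := d.elim
  pullback _ w := w.elim
  arc_loop _ h := absurd (Or.inl trivial) h
  vert_injective w := w.elim

end GraphEmbedding

/-! ### Classes of embeddings, edges, stars and formal sums. -/

namespace Emb

variable {G K H H' : ConnGraph.{u} F}

theorem exists_rep (x : Emb G) : ∃ (H : ConnGraph.{u} F) (f : GraphEmbedding H G), mk f = x := by
  obtain ⟨⟨H, f⟩, h⟩ := Quotient.exists_rep x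
  exact ⟨H, f, h⟩

@[simp] theorem verts_mk (f : GraphEmbedding H G) : (mk f).verts = Set.range f.vert := rfl

@[simp] theorem boundary_mk (f : GraphEmbedding H G) : (mk f).boundary = f.arc '' H.bd := rfl

@[simp] theorem map_mk (g : GraphEmbedding G K) (f : GraphEmbedding H G) :
    map g (mk f) = mk (f.comp g) := rfl

theorem mk_le_mk {f : GraphEmbedding H G} {f' : GraphEmbedding H' G} :
    mk f ≤ mk f' ↔ ∃ z : EtaleMap H.toFeynmanGraph H'.toFeynmanGraph,
      z.comp f'.toEtaleMap = f.toEtaleMap := Iff.rfl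

theorem mk_eq_mk {f : GraphEmbedding H G} {f' : GraphEmbedding H' G} :
    mk f = mk f' ↔ ∃ z : EtaleMap H.toFeynmanGraph H'.toFeynmanGraph,
      z.IsIso ∧ z.comp f'.toEtaleMap = f.toEtaleMap := Quotient.eq

theorem verts_map (g : GraphEmbedding G K) (x : Emb G) : (map g x).verts = g.vert '' x.verts := by
  obtain ⟨H, f, rfl⟩ := x.exists_rep
  exact Set.range_comp g.vert f.vert

theorem boundary_map (g : GraphEmbedding G K) (x : Emb G) :
    (map g x).boundary = g.arc '' x.boundary := by
  obtain ⟨H, f, rfl⟩ := x.exists_rep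
  exact Set.image_comp g.arc f.arc H.bd

/-- A class of embeddings is determined by its vertices and its boundary. -/
theorem ext {x y : Emb G} (hv : x.verts = y.verts) (hb : x.boundary = y.boundary) : x = y := by
  obtain ⟨H, f, rfl⟩ := x.exists_rep
  obtain ⟨H', f', rfl⟩ := y.exists_rep
  rw [verts_mk, verts_mk] at hv
  rw [boundary_mk, boundary_mk] at hb
  rw [mk_eq_mk]
  rcases isEmpty_or_nonempty H.V with hV | hV
  · have hV' : IsEmpty H'.V := by
      rw [← Set.range_eq_empty_iff (f := f'.vert), ← hv, Set.range_eq_empty_iff]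
      exact hV
    have hD := H.isEmpty_D
    have hD' := H'.isEmpty_D
    have hbb : H.bd = ∅ ↔ H'.bd = ∅ := by
      rw [← Set.image_eq_empty (f := f.arc), hb, Set.image_eq_empty]
    -- Nodeless loops are surjective on arcs; for edges the boundary is all arcs.
    have hr : Set.range f.arc = Set.range f'.arc := by
      rcases H.bd.eq_empty_or_nonempty with h | h
      · rw [(f.surjective_of_bd_eq_empty h).1.range_eq,
          (f'.surjective_of_bd_eq_empty (hbb.1 h)).1.range_eq]
      · have h' : H'.bd.Nonempty := by
          rw [Set.nonempty_iff_ne_empty, Ne, ← hbb]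
          exact h.ne_empty
        rwa [H.bd_eq_univ h, H'.bd_eq_univ h', Set.image_univ, Set.image_univ] at hb
    obtain ⟨z, hz⟩ := f.exists_lift_of_isEmpty f' hr.subset hbb.1
    obtain ⟨y, hy⟩ := f'.exists_lift_of_isEmpty f hr.symm.subset hbb.2
    have hz' : ∀ a, f'.arc (z.arc a) = f.arc a := congrFun (congrArg EtaleMap.arc hz)
    have hy' : ∀ a, f.arc (y.arc a) = f'.arc a := congrFun (congrArg EtaleMap.arc hy)
    refine ⟨z, ⟨y, ?_, ?_⟩, hz⟩
    · exact EtaleMap.ext (funext fun a => f.arc_injective ((hy' _).trans (hz' a)))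
        (funext isEmptyElim) (funext isEmptyElim)
    · exact EtaleMap.ext (funext fun a => f'.arc_injective ((hz' _).trans (hy' a)))
        (funext isEmptyElim) (funext isEmptyElim)
  · have hV' : Nonempty H'.V := by
      rw [← Set.range_nonempty_iff_nonempty (f := f'.vert), ← hv,
        Set.range_nonempty_iff_nonempty]
      exact hV
    obtain ⟨z, hz⟩ := f.exists_lift_of_eq f' hv.subset hb.symm.subset
    obtain ⟨y, hy⟩ := f'.exists_lift_of_eq f hv.symm.subset hb.subset
    -- Injectivity on vertices and darts makes the two lifts mutually inverse.
    refine ⟨z, ⟨y, ?_, ?_⟩, hz⟩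
    · exact EtaleMap.ext_of_nonempty
        (fun v => f.vert_injective ((congrFun (congrArg EtaleMap.vert hy) _).trans
          (congrFun (congrArg EtaleMap.vert hz) v)))
        (fun d => f.dart_injective ((congrFun (congrArg EtaleMap.dart hy) _).trans
          (congrFun (congrArg EtaleMap.dart hz) d)))
    · exact EtaleMap.ext_of_nonempty
        (fun v => f'.vert_injective ((congrFun (congrArg EtaleMap.vert hz) _).trans
          (congrFun (congrArg EtaleMap.vert hy) v)))
        (fun d => f'.dart_injective ((congrFun (congrArg EtaleMap.dart hz) _).trans
          (congrFun (congrArg EtaleMap.dart hy) d)))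

theorem verts_edge (a : G.A) : (mk (GraphEmbedding.edge G a)).verts = ∅ :=
  Set.range_eq_empty_iff.2 (inferInstanceAs (IsEmpty PEmpty))

theorem boundary_edge (a : G.A) : (mk (GraphEmbedding.edge G a)).boundary = {a, G.inv a} := by
  ext b
  constructor
  · rintro ⟨⟨_ | _⟩, -, rfl⟩
    · exact Or.inr rfl
    · exact Or.inl rfl
  · rintro (rfl | rfl)
    · exact ⟨⟨true⟩, trivial, rfl⟩
    · exact ⟨⟨false⟩, trivial, rfl⟩

theorem verts_eq_empty_iff {f : GraphEmbedding H G} : (mk f).verts = ∅ ↔ IsEmpty H.V :=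
  Set.range_eq_empty_iff

theorem exists_eq_edge {x : Emb G} (hv : x.verts = ∅) (hb : x.boundary.Nonempty) :
    ∃ a, x = mk (GraphEmbedding.edge G a) := by
  obtain ⟨H, f, rfl⟩ := x.exists_rep
  have hV := verts_eq_empty_iff.1 hv
  obtain ⟨_, a, ha, rfl⟩ := hb
  refine ⟨f.arc a, ext (by rw [hv, verts_edge]) ?_⟩
  rw [boundary_edge, boundary_mk, H.bd_eq_univ ⟨a, ha⟩]
  ext b
  constructor
  · rintro ⟨c, -, rfl⟩
    rcases H.eq_or_eq_inv a c with rfl | rfl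
    · exact Or.inl rfl
    · exact Or.inr (f.arc_inv a)
  · rintro (rfl | rfl)
    · exact ⟨a, trivial, rfl⟩
    · exact ⟨H.inv a, trivial, f.arc_inv a⟩

/-- Among vertexless graphs, a nonempty boundary tells the edge from the nodeless loop. -/
theorem isEdge_iff {x : Emb G} : x.IsEdge ↔ x.verts = ∅ ∧ x.boundary.Nonempty := by
  constructor
  · rintro ⟨H, f, rfl, z, y, hzy, hyz⟩
    refine ⟨verts_eq_empty_iff.2 ⟨fun v => (z.vert v).elim⟩, ?_⟩
    rw [boundary_mk, ← EtaleMap.image_bd_of_inverse y z hyz hzy]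
    exact ⟨_, _, ⟨⟨true⟩, trivial, rfl⟩, rfl⟩
  · rintro ⟨hv, hb⟩
    obtain ⟨a, rfl⟩ := exists_eq_edge hv hb
    exact ⟨_, _, rfl, EtaleMap.id _, EtaleMap.id _, rfl, rfl⟩

theorem inv_mem_boundary {x : Emb G} (h : x.verts = ∅) {a : G.A} (ha : a ∈ x.boundary) :
    G.inv a ∈ x.boundary := by
  obtain ⟨b, rfl⟩ := exists_eq_edge h ⟨a, ha⟩
  rw [boundary_edge] at ha ⊢
  rcases ha with rfl | rfl
  · exact Or.inr rfl
  · exact Or.inl (G.inv_inv b)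

theorem isEdge_map {g : GraphEmbedding G K} {x : Emb G} : (map g x).IsEdge ↔ x.IsEdge := by
  rw [isEdge_iff, isEdge_iff, verts_map, boundary_map, Set.image_eq_empty, Set.image_nonempty]

/-- The domain has empty boundary, so the embedding is surjective and `G` has no vertices either. -/
theorem isNodelessLoop {x : Emb G} (hv : x.verts = ∅) (hb : x.boundary = ∅) :
    G.IsNodelessLoop ∧ F ≠ Flavor.ordinary := by
  obtain ⟨H, f, rfl⟩ := x.exists_rep
  have hV := verts_eq_empty_iff.1 hv
  rw [boundary_mk, Set.image_eq_empty] at hb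
  have : IsEmpty G.V := by
    refine ⟨fun v => ?_⟩
    obtain ⟨w, -⟩ := (f.surjective_of_bd_eq_empty hb).2 v
    exact isEmptyElim w
  exact ⟨G.isNodelessLoop_of (f.bd_eq_empty hb), H.not_ordinary_of hb⟩

theorem verts_star (v : G.V) : (mk (GraphEmbedding.star G v)).verts = {v} := by
  ext w
  constructor
  · rintro ⟨_, rfl⟩
    rfl
  · rintro rfl
    exact ⟨PUnit.unit, rfl⟩

theorem boundary_star (v : G.V) :
    (mk (GraphEmbedding.star G v)).boundary = (fun d => G.inv (G.s d)) '' G.nbhd v := by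
  ext a
  constructor
  · rintro ⟨_, ⟨d, rfl⟩, rfl⟩
    exact ⟨d.1, d.2, rfl⟩
  · rintro ⟨d, hd, rfl⟩
    exact ⟨Sum.inr ⟨d, hd⟩, ⟨⟨d, hd⟩, rfl⟩, rfl⟩

/-- The star cuts every edge at `v`, so the condition on cut edges in `exists_lift` is automatic. -/
theorem star_le {x : Emb G} {v : G.V} (h : v ∈ x.verts) :
    mk (GraphEmbedding.star G v) ≤ x := by
  obtain ⟨H, f, rfl⟩ := x.exists_rep
  have : Nonempty (starGraph G v).V := ⟨PUnit.unit⟩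
  refine mk_le_mk.2 (GraphEmbedding.exists_lift _ f ?_ fun d _ => ⟨d, rfl⟩)
  rw [← verts_mk, verts_star]
  rintro _ rfl
  exact h

section Sums

variable {S T I : Type u} [Finite S] [Finite T] [Finite I]

theorem mem_sumOf {A : Set S} {a : S} : a ∈ sumOf A ↔ a ∈ A := by simp [sumOf]

theorem nodup_sumOf (A : Set S) : (sumOf A).Nodup := Finset.nodup _

/-- `sumOf` has no repetitions, so equality of multisets also records injectivity of `f` on `A`. -/
theorem sumOf_eq_map_iff {A : Set S} {B : Set T} {f : S → T} :
    sumOf B = Multiset.map f (sumOf A) ↔ Set.BijOn f A B := by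
  constructor
  · intro h
    have hm : ∀ b, b ∈ B ↔ ∃ a ∈ A, f a = b := fun b => by
      rw [← mem_sumOf, h, Multiset.mem_map]
      simp only [mem_sumOf]
    refine ⟨fun a ha => (hm _).2 ⟨a, ha, rfl⟩, fun a ha b hb hab => ?_, fun b hb => (hm b).1 hb⟩
    have hn : (Multiset.map f (sumOf A)).Nodup := h ▸ nodup_sumOf B
    exact Multiset.inj_on_of_nodup_map hn a (mem_sumOf.2 ha) b (mem_sumOf.2 hb) hab
  · intro h
    refine (Multiset.Nodup.ext (nodup_sumOf B) ?_).2 fun b => ?_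
    · exact (nodup_sumOf A).map_on fun a ha b hb => h.injOn (mem_sumOf.1 ha) (mem_sumOf.1 hb)
    · rw [mem_sumOf, Multiset.mem_map, ← h.image_eq]
      simp only [mem_sumOf]
      rfl

theorem finsum_sumOf_le_iff {A : I → Set S} :
    (∑ᶠ i, sumOf (A i)) ≤ ∑ᶠ w : S, ({w} : Multiset S) ↔
      ∀ i j w, w ∈ A i → w ∈ A j → i = j := by
  classical
  have := Fintype.ofFinite I
  have := Fintype.ofFinite S
  have hc : ∀ (B : Set S) w, Multiset.count w (sumOf B) = if w ∈ B then 1 else 0 := fun B w => by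
    simp only [Multiset.count_eq_of_nodup (nodup_sumOf B), mem_sumOf]
  have hr : ∀ w, Multiset.count w (∑ w' : S, ({w'} : Multiset S)) = 1 := fun w => by
    simp
  rw [finsum_eq_sum_of_fintype, finsum_eq_sum_of_fintype, Multiset.le_iff_count]
  simp only [hr, Multiset.count_sum', hc]
  constructor
  · intro h i j w hi hj
    by_contra hij
    have h2 := Finset.sum_le_sum_of_subset (f := fun i => if w ∈ A i then 1 else 0)
      (Finset.subset_univ {i, j})
    rw [Finset.sum_pair hij, if_pos hi, if_pos hj] at h2
    exact absurd (h2.trans (h w)) (by norm_num)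
  · intro h w
    by_cases hw : ∃ i, w ∈ A i
    · obtain ⟨i, hi⟩ := hw
      rw [Finset.sum_eq_single i (fun j _ hj => if_neg fun hjw => hj (h j i w hjw hi))
        (fun hn => absurd (Finset.mem_univ i) hn), if_pos hi]
    · rw [Finset.sum_eq_zero fun i _ => if_neg fun hi => hw ⟨i, hi⟩]
      exact zero_le_one

end Sums

end Emb

namespace Emb

variable {G K H H' : ConnGraph.{u} F}

theorem exists_dart_of_mem_boundary {x : Emb G} (hv : x.verts.Nonempty) {b : G.A}
    (hb : b ∈ x.boundary) : ∃ e, G.s e = G.inv b ∧ G.t e ∈ x.verts := by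
  obtain ⟨H, f, rfl⟩ := x.exists_rep
  obtain ⟨_, w, rfl⟩ := hv
  obtain ⟨a, ha, rfl⟩ := hb
  have : Nonempty H.V := ⟨w⟩
  obtain ⟨d, hd⟩ := H.exists_s_eq_inv ha
  exact ⟨f.dart d, by rw [← f.arc_s, hd, f.arc_inv], H.t d, f.vert_t d⟩

theorem IsEdge.eq_or_eq_inv {x : Emb G} (hx : x.IsEdge) {p q : G.A} (hp : p ∈ x.boundary)
    (hq : q ∈ x.boundary) : q = p ∨ q = G.inv p := by
  obtain ⟨hv, hb⟩ := isEdge_iff.1 hx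
  obtain ⟨a, rfl⟩ := exists_eq_edge hv hb
  rw [boundary_edge] at hp hq
  rcases hp with rfl | rfl
  · exact hq
  · rw [G.inv_inv]
    exact hq.symm

theorem verts_nonempty {x : Emb G} (hx : ¬ x.IsEdge) (hb : x.boundary.Nonempty) :
    x.verts.Nonempty :=
  Set.nonempty_iff_ne_empty.2 fun h => hx (isEdge_iff.2 ⟨h, hb⟩)

end Emb

/-! ### Graphical maps and walks through vertices sent to edges. -/

namespace GraphicalMap

variable {G K H L : ConnGraph.{u} F}

/-- A graphical map, from conditions on sets. -/
def ofBijOn (arc : G.A → K.A) (vert : G.V → Emb K) (arc_inv : ∀ a, arc (G.inv a) = K.inv (arc a))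
    (hdisj : ∀ v v' w, w ∈ (vert v).verts → w ∈ (vert v').verts → v = v')
    (hbij : ∀ v, Set.BijOn (fun d => arc (G.inv (G.s d))) (G.nbhd v) (vert v).boundary)
    (hc : G.bd = ∅ → (∀ v, (vert v).IsEdge) → K.IsNodelessLoop ∧ F ≠ Flavor.ordinary) :
    GraphicalMap G K where
  arc := arc
  vert := vert
  arc_inv := arc_inv
  vertexSum_le := Emb.finsum_sumOf_le_iff.2 hdisj
  boundary_vert v := ⟨(hbij v).equiv, fun _ => rfl⟩
  collapse hF hbd := by
    by_contra h
    exact (hc hbd fun v => by_contra fun hv => h ⟨v, hv⟩).2 hF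
  collapse_extended _ hbd h := (hc hbd h).1

variable (φ : GraphicalMap G K)

theorem eq_of_mem_verts {v v' : G.V} {w : K.V} (h : w ∈ (φ.vert v).verts)
    (h' : w ∈ (φ.vert v').verts) : v = v' :=
  Emb.finsum_sumOf_le_iff.1 φ.vertexSum_le v v' w h h'

theorem bijOn (v : G.V) :
    Set.BijOn (fun d => φ.arc (G.inv (G.s d))) (G.nbhd v) (φ.vert v).boundary := by
  obtain ⟨e, he⟩ := φ.boundary_vert v
  refine ⟨fun d hd => ?_, fun d hd d' hd' h => ?_, fun b hb => ?_⟩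
  · change φ.arc (G.inv (G.s d)) ∈ _
    rw [← he ⟨d, hd⟩]
    exact (e _).2
  · have : e ⟨d, hd⟩ = e ⟨d', hd'⟩ := Subtype.ext (by rw [he, he]; exact h)
    exact congrArg Subtype.val (e.injective this)
  · obtain ⟨d, hd⟩ := e.surjective ⟨b, hb⟩
    exact ⟨d.1, d.2, (he d).symm.trans (congrArg Subtype.val hd)⟩

theorem arc_mem_boundary (d : G.D) : φ.arc (G.inv (G.s d)) ∈ (φ.vert (G.t d)).boundary :=
  (φ.bijOn (G.t d)).mapsTo rfl

theorem exists_of_mem_boundary {v : G.V} {b : K.A} (h : b ∈ (φ.vert v).boundary) :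
    ∃ d, G.t d = v ∧ φ.arc (G.inv (G.s d)) = b := (φ.bijOn v).surjOn h

/-- Separation of the darts at one vertex by φ₀ is what makes walks deterministic. -/
theorem dart_eq {d e : G.D} (ht : G.t d = G.t e) (h : φ.arc (G.s d) = φ.arc (G.s e)) : d = e :=
  (φ.bijOn (G.t e)).injOn ht rfl (by
    rw [φ.arc_inv, φ.arc_inv, h])

/-- All vertices go to edges, and there is no boundary. -/
def Collapses : Prop := G.bd = ∅ ∧ ∀ v, (φ.vert v).IsEdge

variable {φ}

theorem Collapses.isNodelessLoop (h : φ.Collapses) : K.IsNodelessLoop ∧ F ≠ Flavor.ordinary := by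
  cases F
  · obtain ⟨v, hv⟩ := φ.collapse rfl h.1
    exact absurd (h.2 v) hv
  · exact ⟨φ.collapse_extended rfl h.1 h.2, fun h => by cases h⟩

variable (φ)

/-- The restriction of a graphical map along an embedding. -/
def precomp (f : GraphEmbedding H G) : GraphicalMap H K :=
  ofBijOn (fun a => φ.arc (f.arc a)) (fun v => φ.vert (f.vert v))
    (fun a => by rw [f.arc_inv, φ.arc_inv])
    (fun _ _ _ h h' => f.vert_injective (φ.eq_of_mem_verts h h'))
    (fun v => by
      refine ⟨fun d hd => ?_, fun d hd d' hd' h => ?_, fun b hb => ?_⟩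
      · have h := φ.arc_mem_boundary (f.dart d)
        rw [← f.vert_t, hd, ← f.arc_s, ← f.arc_inv] at h
        exact h
      · refine f.dart_injective (φ.dart_eq ?_ ?_)
        · rw [← f.vert_t, ← f.vert_t, hd, hd']
        · simp only [f.arc_inv, φ.arc_inv] at h
          rw [← f.arc_s, ← f.arc_s]
          exact K.inv_injective h
      · obtain ⟨e, he, rfl⟩ := φ.exists_of_mem_boundary hb
        obtain ⟨d, rfl, hd⟩ := f.exists_dart he
        refine ⟨d, hd, ?_⟩
        change φ.arc (f.arc (H.inv (H.s d))) = _
        rw [f.arc_inv, f.arc_s])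
    -- If `H` has no boundary then `f` is surjective, so a collapse of the restriction is a collapse
    -- of `φ`.
    (fun hb he => Collapses.isNodelessLoop (φ := φ) ⟨f.bd_eq_empty hb, fun v => by
      obtain ⟨w, rfl⟩ := (f.surjective_of_bd_eq_empty hb).2 v
      exact he w⟩)

/-- Passing through a vertex that is sent to an edge. -/
def Step (a a' : G.A) : Prop :=
  ∃ d e, G.s d = a ∧ G.inv (G.s e) = a' ∧ G.t d = G.t e ∧ (φ.vert (G.t d)).IsEdge ∧
    φ.arc a' = φ.arc a

/-- The arcs from which no step is possible (outside of nodeless loops). -/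
def Terminal (a : G.A) : Prop := a ∈ G.bd ∨ ∃ d, G.s d = a ∧ ¬ (φ.vert (G.t d)).IsEdge

variable {φ}

/-- Reversibility, combined with `Step.unique`, shows that an arc also has at most one predecessor.
-/
theorem Step.inv {a a' : G.A} (h : φ.Step a a') : φ.Step (G.inv a') (G.inv a) := by
  obtain ⟨d, e, rfl, rfl, ht, he, ha⟩ := h
  exact ⟨e, d, (G.inv_inv _).symm, rfl, ht.symm, ht ▸ he, by rw [φ.arc_inv, φ.arc_inv, ha]⟩

theorem Step.unique {a b c : G.A} (h : φ.Step a b) (h' : φ.Step a c) : b = c := by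
  obtain ⟨d, e, rfl, rfl, ht, -, ha⟩ := h
  obtain ⟨d', e', hd, rfl, ht', -, ha'⟩ := h'
  obtain rfl := G.s_injective hd
  rw [← ha', φ.arc_inv, φ.arc_inv] at ha
  rw [φ.dart_eq (ht.symm.trans ht') (K.inv_injective ha)]

theorem Terminal.not_step {a b : G.A} (h : φ.Terminal a) : ¬ φ.Step a b := by
  rintro ⟨d, e, rfl, -, -, he, -⟩
  rcases h with h | ⟨d', hd, h⟩
  · exact G.s_notMem_bd d h
  · rw [G.s_injective hd] at h
    exact h he

theorem exists_step {d : G.D} (h : (φ.vert (G.t d)).IsEdge) : ∃ a, φ.Step (G.s d) a := by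
  have h1 := Emb.inv_mem_boundary (Emb.isEdge_iff.1 h).1 (φ.arc_mem_boundary d)
  rw [φ.arc_inv, K.inv_inv] at h1
  obtain ⟨e, he, h2⟩ := φ.exists_of_mem_boundary h1
  exact ⟨_, d, e, rfl, rfl, he.symm, h, h2⟩

open Relation in
theorem exists_terminal (h : ¬ φ.Collapses) (a : G.A) :
    ∃ a', φ.Terminal a' ∧ ReflTransGen φ.Step a a' := by
  by_contra hcon
  apply h
  have hnt : ∀ b, ReflTransGen φ.Step a b → ¬ φ.Terminal b := fun b hb ht => hcon ⟨b, ht, hb⟩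
  rcases isEmpty_or_nonempty G.V with hV | hV
  · refine ⟨?_, isEmptyElim⟩
    by_contra hne
    refine hnt a .refl (Or.inl ?_)
    rw [G.bd_eq_univ (Set.nonempty_iff_ne_empty.2 hne)]
    trivial
  have hstep : ∀ b, ReflTransGen φ.Step a b → ∃ c, φ.Step b c := by
    intro b hb
    rcases G.mem_bd_or_range b with hb' | ⟨d, rfl⟩
    · exact absurd (Or.inl hb') (hnt b hb)
    · exact exists_step (by_contra fun hd => hnt _ hb (Or.inr ⟨d, rfl, hd⟩))
  -- A walk that never stops gives an injective self-map of a finite set. It is therefore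
  -- surjective: the walk is a cycle.
  let next : {b // ReflTransGen φ.Step a b} → {b // ReflTransGen φ.Step a b} := fun b =>
    ⟨(hstep b.1 b.2).choose, b.2.tail (hstep b.1 b.2).choose_spec⟩
  have hnext : ∀ b, φ.Step b.1 (next b).1 := fun b => (hstep b.1 b.2).choose_spec
  have hinj : Function.Injective next := fun b c hbc => Subtype.ext (G.inv_injective
    ((hnext b).inv.unique (hbc ▸ (hnext c).inv)))
  have hsurj := Finite.injective_iff_surjective.1 hinj
  have hprev : ∀ c, ReflTransGen φ.Step a c → ∃ b, ReflTransGen φ.Step a b ∧ φ.Step b c := by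
    intro c hc
    obtain ⟨b, hb⟩ := hsurj ⟨c, hc⟩
    refine ⟨b.1, b.2, ?_⟩
    have := hnext b
    rwa [hb] at this
  -- The arcs of the cycle, their inverses and its vertices form a summand, hence all of `G`, which
  -- therefore collapses.
  rcases G.connected.2 {b | ReflTransGen φ.Step a b ∨ ReflTransGen φ.Step a (G.inv b)}
    {v | ∃ d, ReflTransGen φ.Step a (G.s d) ∧ G.t d = v}
    (fun b => by
      simp only [Set.mem_ofPred_eq, G.inv_inv]
      exact or_comm)
    (fun d => by
      constructor
      · rintro (hd | hd)
        · exact ⟨d, hd, rfl⟩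
        · obtain ⟨_, hb, d', e, rfl, he, ht, -⟩ := hprev _ hd
          obtain rfl := G.s_injective (G.inv_injective he)
          exact ⟨d', hb, ht⟩
      · rintro ⟨d', hd', ht⟩
        obtain ⟨c, hc⟩ := hstep _ hd'
        have hc' := hd'.tail hc
        obtain ⟨d'', e, hs, rfl, ht', he, ha⟩ := hc
        obtain rfl := G.s_injective hs
        have hd := φ.arc_mem_boundary d
        rw [← ht] at hd
        -- An edge has only two boundary arcs, so `d` is the dart by which the cycle enters the
        -- vertex or the one by which it leaves.
        rcases he.eq_or_eq_inv (φ.arc_mem_boundary _) hd with h1 | h1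
        · left
          rw [φ.arc_inv, φ.arc_inv] at h1
          rwa [φ.dart_eq ht.symm (K.inv_injective h1)]
        · right
          rw [φ.arc_inv, φ.arc_inv] at h1
          rw [φ.arc_inv] at ha
          rwa [← φ.dart_eq (ht'.symm.trans ht) (K.inv_injective (by rw [ha, h1, K.inv_inv]))]) with h1 | h1
  · exact absurd h1.1 (Set.nonempty_iff_ne_empty.1 ⟨a, Or.inl .refl⟩)
  · refine ⟨Set.eq_empty_of_forall_notMem fun b hb => ?_, fun v => ?_⟩
    · rcases (Set.ext_iff.1 h1.1 b).2 trivial with h2 | h2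
      · exact hnt _ h2 (Or.inl hb)
      · obtain ⟨_, -, d', e, -, he, -⟩ := hprev _ h2
        rw [← G.inv_injective he] at hb
        exact G.s_notMem_bd _ hb
    · obtain ⟨d, hd, rfl⟩ := (Set.ext_iff.1 h1.2 v).2 trivial
      by_contra hv
      exact hnt _ hd (Or.inr ⟨d, rfl, hv⟩)

/-- The last arc of the walk through vertices that are sent to edges. -/
noncomputable def last (h : ¬ φ.Collapses) (a : G.A) : G.A := (exists_terminal h a).choose

section Last

open Relation

variable (h : ¬ φ.Collapses)

theorem terminal_last (a : G.A) : φ.Terminal (last h a) := (exists_terminal h a).choose_spec.1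

theorem reflTransGen_last (a : G.A) : ReflTransGen φ.Step a (last h a) :=
  (exists_terminal h a).choose_spec.2

theorem Terminal.eq_of_reflTransGen {a b : G.A} (ha : φ.Terminal a)
    (hab : ReflTransGen φ.Step a b) : a = b := by
  rcases hab.cases_head with hab | ⟨c, hc, -⟩
  · exact hab
  · exact absurd hc ha.not_step

/-- Steps are deterministic, so of two walks from one arc one extends the other. -/
theorem last_eq_last {a b : G.A} (hab : ReflTransGen φ.Step a b) : last h a = last h b := by
  have h1 := hab.trans (reflTransGen_last h b)
  rcases ReflTransGen.total_of_right_unique (fun _ _ _ => Step.unique)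
    (reflTransGen_last h a) h1 with h2 | h2
  · exact (terminal_last h a).eq_of_reflTransGen h2
  · exact ((terminal_last h b).eq_of_reflTransGen h2).symm

theorem last_of_terminal {a : G.A} (ha : φ.Terminal a) : last h a = a :=
  (ha.eq_of_reflTransGen (reflTransGen_last h a)).symm

theorem arc_eq_of_reflTransGen {a b : G.A} (hab : ReflTransGen φ.Step a b) :
    φ.arc b = φ.arc a := by
  induction hab with
  | refl => rfl
  | tail _ hs ih =>
    obtain ⟨_, _, _, _, _, _, hs⟩ := hs
    rw [hs, ih]

theorem arc_last (a : G.A) : φ.arc (last h a) = φ.arc a :=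
  arc_eq_of_reflTransGen (reflTransGen_last h a)

theorem reflTransGen_inv {a b : G.A} (hab : ReflTransGen φ.Step a b) :
    ReflTransGen φ.Step (G.inv b) (G.inv a) := by
  induction hab with
  | refl => exact .refl
  | tail _ hs ih => exact ih.head hs.inv

/-- The reversed walk leads from the inverse of `last h a` to the inverse of `a`. This makes
`arcMap` compatible with involutions. -/
theorem last_inv_last (a : G.A) : last h (G.inv (last h a)) = last h (G.inv a) :=
  last_eq_last h (reflTransGen_inv (reflTransGen_last h a))

end Last

theorem exists_dart_of_not_isEdge {d : G.D} (h : ¬ (φ.vert (G.t d)).IsEdge) :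
    ∃ e, K.s e = φ.arc (G.s d) ∧ K.t e ∈ (φ.vert (G.t d)).verts := by
  obtain ⟨e, he, ht⟩ := Emb.exists_dart_of_mem_boundary
    (Emb.verts_nonempty h ⟨_, φ.arc_mem_boundary d⟩) (φ.arc_mem_boundary d)
  exact ⟨e, by rw [he, φ.arc_inv, K.inv_inv], ht⟩

/-- Active maps are surjective on vertices. -/
theorem IsActive.exists_mem_verts (h : φ.IsActive) (w : K.V) : ∃ v, w ∈ (φ.vert v).verts := by
  have hr := fun v => (φ.vert v).exists_rep
  choose L g hg using hr
  have hnc : ¬ φ.Collapses := fun hc => hc.isNodelessLoop.1.2.1.false w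
  -- The walk from `a` cannot end in the boundary, which an active map sends to the boundary; so it
  -- ends at a vertex not sent to an edge.
  have hkey : ∀ a d, K.s d = φ.arc a → ∃ v, K.t d ∈ (φ.vert v).verts := by
    intro a d hd
    rw [← arc_last hnc] at hd
    rcases terminal_last hnc a with hb | ⟨e, he, hne⟩
    · exact absurd (h.mapsTo hb) (hd ▸ K.s_notMem_bd d)
    · obtain ⟨c, hc, ht⟩ := exists_dart_of_not_isEdge hne
      rw [he, ← hd] at hc
      exact ⟨_, K.s_injective hc ▸ ht⟩
  -- The arcs hit by φ₀ or by some φ₁(v), with the vertices of the φ₁(v), form a summand of `K`.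
  rcases K.connected.2 {b | (∃ a, φ.arc a = b) ∨ ∃ v a, (g v).arc a = b}
    {w | ∃ v, w ∈ (φ.vert v).verts}
    (fun b => by
      constructor
      · rintro (⟨a, ha⟩ | ⟨v, a, ha⟩)
        · exact Or.inl ⟨G.inv a, by rw [φ.arc_inv, ha, K.inv_inv]⟩
        · exact Or.inr ⟨v, (L v).inv a, by rw [(g v).arc_inv, ha, K.inv_inv]⟩
      · rintro (⟨a, rfl⟩ | ⟨v, a, rfl⟩)
        · exact Or.inl ⟨G.inv a, φ.arc_inv a⟩
        · exact Or.inr ⟨v, (L v).inv a, (g v).arc_inv a⟩)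
    (fun d => by
      constructor
      · rintro (⟨a, ha⟩ | ⟨v, a, ha⟩)
        · exact hkey a d ha.symm
        · by_cases hr : ∃ e, (L v).s e = a
          · obtain ⟨e, rfl⟩ := hr
            refine ⟨v, ?_⟩
            rw [← hg v, ← (g v).s_eq_arc_s ha, ← (g v).vert_t]
            exact ⟨_, rfl⟩
          by_cases hb : a ∈ (L v).bd
          · obtain ⟨e, -, he⟩ := φ.exists_of_mem_boundary (v := v) (b := (g v).arc a) (by
              rw [← hg v]
              exact ⟨a, hb, rfl⟩)
            exact hkey _ d (ha.symm.trans he.symm)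
          · exact absurd (Or.inr ⟨d, ha.symm⟩) ((g v).arc_loop a fun h' => h'.elim hb hr)
      · rintro ⟨v, hv⟩
        rw [← hg v] at hv
        obtain ⟨w', hw'⟩ := hv
        obtain ⟨c, hc, -⟩ := (g v).exists_dart hw'.symm
        exact Or.inr ⟨v, (L v).s c, by rw [(g v).arc_s, hc]⟩) with ⟨h1, h2⟩ | ⟨h1, h2⟩
  · exfalso
    rcases G.connected.1 with ⟨⟨a⟩⟩ | ⟨⟨v⟩⟩
    · exact absurd h1 (Set.nonempty_iff_ne_empty.1 ⟨_, Or.inl ⟨a, rfl⟩⟩)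
    · rcases (L v).connected.1 with ⟨⟨a⟩⟩ | ⟨⟨w'⟩⟩
      · exact absurd h1 (Set.nonempty_iff_ne_empty.1 ⟨_, Or.inr ⟨v, a, rfl⟩⟩)
      · exact absurd h2 (Set.nonempty_iff_ne_empty.1 ⟨(g v).vert w', v, by
          rw [← hg v]
          exact ⟨w', rfl⟩⟩)
  · exact (Set.ext_iff.1 h2 w).2 trivial

end GraphicalMap

/-! ### Graph substitution and the active-inert factorization. -/

namespace GraphicalMap

variable {G K : ConnGraph.{u} F}

/-- Representatives of the embeddings which are the values of a graphical map on vertices, where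
the graphical map is such that no nodeless loops arise by substitution. -/
structure Representatives (φ : GraphicalMap G K) where
  graph : G.V → ConnGraph.{u} F
  emb : ∀ v, GraphEmbedding (graph v) K
  mk_emb : ∀ v, Emb.mk (emb v) = φ.vert v
  not_collapses : ¬ φ.Collapses
  isEdge_of_verts : ∀ v, (φ.vert v).verts = ∅ → (φ.vert v).IsEdge

namespace Representatives

variable {φ : GraphicalMap G K} (R : φ.Representatives)

theorem mem_verts (v : G.V) (w : (R.graph v).V) : (R.emb v).vert w ∈ (φ.vert v).verts := by
  rw [← R.mk_emb]
  exact ⟨w, rfl⟩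

theorem mem_boundary (v : G.V) {a : (R.graph v).A} (h : a ∈ (R.graph v).bd) :
    (R.emb v).arc a ∈ (φ.vert v).boundary := by
  rw [← R.mk_emb]
  exact ⟨a, h, rfl⟩

theorem exists_dart (v : G.V) {a : (R.graph v).A} (h : a ∈ (R.graph v).bd) :
    ∃ x, G.t x = v ∧ φ.arc (G.inv (G.s x)) = (R.emb v).arc a :=
  φ.exists_of_mem_boundary (R.mem_boundary v h)

theorem exists_bd {v : G.V} {x : G.D} (h : G.t x = v) :
    ∃ a ∈ (R.graph v).bd, (R.emb v).arc a = φ.arc (G.inv (G.s x)) := by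
  have := φ.arc_mem_boundary x
  rw [h, ← R.mk_emb] at this
  exact this

theorem isEdge (v : G.V) [hV : IsEmpty (R.graph v).V] : (φ.vert v).IsEdge := by
  apply R.isEdge_of_verts
  rw [← R.mk_emb]
  exact Emb.verts_eq_empty_iff.2 hV

theorem not_isEdge {v : G.V} (w : (R.graph v).V) : ¬ (φ.vert v).IsEdge := fun h => by
  have := R.mem_verts v w
  rw [(Emb.isEdge_iff.1 h).1] at this
  exact this

theorem bd_eq_univ (v : G.V) [IsEmpty (R.graph v).V] : (R.graph v).bd = Set.univ := by
  apply ConnGraph.bd_eq_univ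
  have := (Emb.isEdge_iff.1 (R.isEdge v)).2
  rwa [← R.mk_emb, Emb.boundary_mk, Set.image_nonempty] at this

theorem mem_bd_or_range (v : G.V) (a : (R.graph v).A) :
    a ∈ (R.graph v).bd ∨ ∃ c, (R.graph v).s c = a := by
  rcases isEmpty_or_nonempty (R.graph v).V with hV | hV
  · left
    rw [R.bd_eq_univ]
    trivial
  · exact (R.graph v).mem_bd_or_range a

/-- The vertices of the graph substitution. -/
abbrev Vert (_ : φ.Representatives) : Type u := {w : K.V // ∃ v, w ∈ (φ.vert v).verts}

/-- The darts of the graph substitution. -/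
abbrev Dart (_ : φ.Representatives) : Type u := {d : K.D // ∃ v, K.t d ∈ (φ.vert v).verts}

/-- The arcs of the graph substitution. -/
abbrev Arc (R : φ.Representatives) : Type u := R.Dart ⊕ G.bd

/-- The map of the graph substitution to the codomain, on arcs. -/
def proj : R.Arc → K.A := Sum.elim (fun d => K.s d.1) (fun b => φ.arc b.1)

/-- A walk ending outside the boundary ends at a vertex whose substitute has vertices, and there φ₀
hits a dart of `K`. This is the dart case of `arcMap`. -/
theorem exists_dart_of_last {a : G.A} (h : last R.not_collapses a ∉ G.bd) :
    ∃ d : R.Dart, K.s d.1 = φ.arc a := by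
  obtain ⟨d, hd, hne⟩ := (terminal_last R.not_collapses a).resolve_left h
  obtain ⟨e, he, ht⟩ := exists_dart_of_not_isEdge hne
  exact ⟨⟨e, _, ht⟩, by rw [he, hd, arc_last]⟩

open Classical in
/-- The active map to the graph substitution, on arcs. -/
noncomputable def arcMap (a : G.A) : R.Arc :=
  if h : last R.not_collapses a ∈ G.bd then Sum.inr ⟨_, h⟩
  else Sum.inl (R.exists_dart_of_last h).choose

theorem arcMap_of_mem {a : G.A} (h : last R.not_collapses a ∈ G.bd) :
    R.arcMap a = Sum.inr ⟨_, h⟩ := dif_pos h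

theorem arcMap_of_notMem {a : G.A} (h : last R.not_collapses a ∉ G.bd) (d : R.Dart)
    (hd : K.s d.1 = φ.arc a) : R.arcMap a = Sum.inl d := by
  rw [arcMap, dif_neg h]
  congr 1
  apply Subtype.ext
  apply K.s_injective
  rw [hd]
  exact (R.exists_dart_of_last h).choose_spec

theorem arcMap_bd (b : G.bd) : R.arcMap b.1 = Sum.inr b := by
  have h := last_of_terminal R.not_collapses (Or.inl b.2)
  have h' : last R.not_collapses b.1 ∈ G.bd := by
    rw [h]
    exact b.2
  rw [R.arcMap_of_mem h']
  congr 1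
  exact Subtype.ext h

theorem arcMap_s {d : G.D} (h : ¬ (φ.vert (G.t d)).IsEdge) (e : R.Dart)
    (he : K.s e.1 = φ.arc (G.s d)) : R.arcMap (G.s d) = Sum.inl e := by
  refine R.arcMap_of_notMem ?_ e he
  rw [last_of_terminal R.not_collapses (Or.inr ⟨d, rfl, h⟩)]
  exact G.s_notMem_bd d

theorem proj_arcMap (a : G.A) : R.proj (R.arcMap a) = φ.arc a := by
  by_cases h : last R.not_collapses a ∈ G.bd
  · rw [R.arcMap_of_mem h]
    exact arc_last R.not_collapses a
  · obtain ⟨d, hd⟩ := R.exists_dart_of_last h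
    rw [R.arcMap_of_notMem h d hd]
    exact hd

theorem arcMap_eq {a b : G.A} (h : last R.not_collapses a = last R.not_collapses b) :
    R.arcMap a = R.arcMap b := by
  have hab : φ.arc a = φ.arc b := by
    rw [← arc_last R.not_collapses, h, arc_last]
  by_cases ha : last R.not_collapses a ∈ G.bd
  · have hb := ha
    rw [h] at hb
    rw [R.arcMap_of_mem ha, R.arcMap_of_mem hb]
    congr 1
    exact Subtype.ext h
  · have hb := ha
    rw [h] at hb
    obtain ⟨d, hd⟩ := R.exists_dart_of_last ha
    rw [R.arcMap_of_notMem ha d hd, R.arcMap_of_notMem hb d (hd.trans hab)]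

/-- The inclusion of the darts of a substituted graph. -/
def dartIncl (v : G.V) (c : (R.graph v).D) : R.Dart :=
  ⟨(R.emb v).dart c, v, by
    rw [← (R.emb v).vert_t]
    exact R.mem_verts v _⟩

open Classical in
/-- The inclusion of the arcs of a substituted graph. -/
noncomputable def arcIncl (v : G.V) (a : (R.graph v).A) : R.Arc :=
  if h : ∃ c, (R.graph v).s c = a then Sum.inl (R.dartIncl v h.choose)
  else R.arcMap (G.inv (G.s (R.exists_dart v ((R.mem_bd_or_range v a).resolve_right h)).choose))

theorem arcIncl_s (v : G.V) (c : (R.graph v).D) :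
    R.arcIncl v ((R.graph v).s c) = Sum.inl (R.dartIncl v c) := by
  have h : ∃ c', (R.graph v).s c' = (R.graph v).s c := ⟨c, rfl⟩
  rw [arcIncl, dif_pos h, (R.graph v).s_injective h.choose_spec]

/-- A boundary arc of the substitute is glued to the corresponding arc of `G`; injectivity of φ₀ at
`v` makes the chosen dart irrelevant. -/
theorem arcIncl_bd {v : G.V} {a : (R.graph v).A} (ha : a ∈ (R.graph v).bd) {x : G.D}
    (hx : G.t x = v) (h : φ.arc (G.inv (G.s x)) = (R.emb v).arc a) :
    R.arcIncl v a = R.arcMap (G.inv (G.s x)) := by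
  have hn : ¬ ∃ c, (R.graph v).s c = a := by
    rintro ⟨c, rfl⟩
    exact (R.graph v).s_notMem_bd c ha
  rw [arcIncl, dif_neg hn]
  have hc := (R.exists_dart v ((R.mem_bd_or_range v a).resolve_right hn)).choose_spec
  congr 3
  exact (φ.bijOn v).injOn hc.1 hx (hc.2.trans h.symm)

theorem proj_arcIncl (v : G.V) (a : (R.graph v).A) :
    R.proj (R.arcIncl v a) = (R.emb v).arc a := by
  rcases R.mem_bd_or_range v a with ha | ⟨c, rfl⟩
  · obtain ⟨x, hx, h⟩ := R.exists_dart v ha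
    rw [R.arcIncl_bd ha hx h, proj_arcMap, h]
  · rw [R.arcIncl_s]
    exact ((R.emb v).arc_s c).symm

theorem exists_dartIncl (d : R.Dart) : ∃ v c, R.dartIncl v c = d := by
  obtain ⟨d, v, hv⟩ := d
  have hv' := hv
  rw [← R.mk_emb] at hv'
  obtain ⟨w, hw⟩ := hv'
  obtain ⟨c, rfl, -⟩ := (R.emb v).exists_dart hw.symm
  exact ⟨v, c, rfl⟩

/-- The involution of the graph substitution. -/
noncomputable def inv : R.Arc → R.Arc :=
  Sum.elim
    (fun d => R.arcIncl _ ((R.graph _).inv ((R.graph _).s (R.exists_dartIncl d).choose_spec.choose)))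
    (fun b => R.arcMap (G.inv b.1))

/-- The φ₁(v) are vertex disjoint and embeddings inject darts, so each dart has a single origin and
the choice in `inv` is harmless. -/
theorem inv_dartIncl (v : G.V) (c : (R.graph v).D) :
    R.inv (Sum.inl (R.dartIncl v c)) = R.arcIncl v ((R.graph v).inv ((R.graph v).s c)) := by
  have key : ∀ v' c', R.dartIncl v' c' = R.dartIncl v c →
      R.arcIncl v' ((R.graph v').inv ((R.graph v').s c')) =
        R.arcIncl v ((R.graph v).inv ((R.graph v).s c)) := by
    intro v' c' h
    have h' : (R.emb v').dart c' = (R.emb v).dart c := congrArg Subtype.val h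
    have hv : v' = v := by
      refine φ.eq_of_mem_verts (w := K.t ((R.emb v).dart c)) ?_ ?_
      · rw [← h', ← (R.emb v').vert_t]
        exact R.mem_verts v' _
      · rw [← (R.emb v).vert_t]
        exact R.mem_verts v _
    subst hv
    rw [(R.emb v').dart_injective h']
  exact key _ _ (R.exists_dartIncl (R.dartIncl v c)).choose_spec.choose_spec

theorem inv_arcMap (a : G.A) : R.inv (R.arcMap a) = R.arcMap (G.inv a) := by
  rw [← R.arcMap_eq (last_inv_last R.not_collapses a)]
  by_cases h : last R.not_collapses a ∈ G.bd
  · rw [R.arcMap_of_mem h]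
    rfl
  · obtain ⟨e, he, hne⟩ := (terminal_last R.not_collapses a).resolve_left h
    -- The boundary arc `b` is glued to the inverse of the final dart `e`, and the inverse of `b` is
    -- the dart that represents `arcMap a`.
    obtain ⟨b, hb, hbe⟩ := R.exists_bd (v := G.t e) rfl
    have hV : Nonempty (R.graph (G.t e)).V := by
      by_contra hV
      have := not_nonempty_iff.1 hV
      exact hne (R.isEdge _)
    obtain ⟨c, hc⟩ := (R.graph (G.t e)).exists_s_eq_inv hb
    rw [R.arcMap_of_notMem h (R.dartIncl _ c), inv_dartIncl, hc, (R.graph _).inv_inv,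
      R.arcIncl_bd hb rfl hbe.symm, he]
    change K.s ((R.emb _).dart c) = _
    rw [← (R.emb _).arc_s, hc, (R.emb _).arc_inv, hbe, φ.arc_inv, K.inv_inv, he, arc_last]

theorem inv_arcIncl (v : G.V) (a : (R.graph v).A) :
    R.inv (R.arcIncl v a) = R.arcIncl v ((R.graph v).inv a) := by
  rcases R.mem_bd_or_range v a with ha | ⟨c, rfl⟩
  · obtain ⟨x, hx, h⟩ := R.exists_dart v ha
    rw [R.arcIncl_bd ha hx h, inv_arcMap, G.inv_inv]
    rcases isEmpty_or_nonempty (R.graph v).V with hV | hV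
    -- Here `v` is replaced by an edge, whose two arcs correspond to darts `x` and `y` at `v`;
    -- passing through `v` is one step.
    · have ha' := (R.graph v).inv_mem_bd ha
      obtain ⟨y, hy, h'⟩ := R.exists_dart v ha'
      rw [R.arcIncl_bd ha' hy h']
      apply R.arcMap_eq
      apply last_eq_last
      refine .single ⟨x, y, rfl, rfl, hx.trans hy.symm, ?_, ?_⟩
      · rw [hx]
        exact R.isEdge v
      · rw [h', (R.emb v).arc_inv, ← h, φ.arc_inv, K.inv_inv]
    · obtain ⟨c, hc⟩ := (R.graph v).exists_s_eq_inv ha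
      rw [← hc, R.arcIncl_s]
      apply R.arcMap_s
      · rw [hx]
        exact R.not_isEdge hV.some
      · change K.s ((R.emb _).dart c) = _
        rw [← (R.emb _).arc_s, hc, (R.emb _).arc_inv, ← h, φ.arc_inv, K.inv_inv]
  · rw [R.arcIncl_s, inv_dartIncl]

/-- Identities about the involution thus need checking only on `arcIncl` and `arcMap`. -/
theorem exists_arc (a : R.Arc) : (∃ v a', R.arcIncl v a' = a) ∨ ∃ a', R.arcMap a' = a := by
  rcases a with d | b
  · obtain ⟨v, c, rfl⟩ := R.exists_dartIncl d
    exact Or.inl ⟨v, _, R.arcIncl_s v c⟩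
  · exact Or.inr ⟨_, R.arcMap_bd b⟩

theorem inv_inv (a : R.Arc) : R.inv (R.inv a) = a := by
  rcases R.exists_arc a with ⟨v, a, rfl⟩ | ⟨a, rfl⟩
  · rw [inv_arcIncl, inv_arcIncl, (R.graph v).inv_inv]
  · rw [inv_arcMap, inv_arcMap, G.inv_inv]

theorem proj_inv (a : R.Arc) : R.proj (R.inv a) = K.inv (R.proj a) := by
  rcases R.exists_arc a with ⟨v, a, rfl⟩ | ⟨a, rfl⟩
  · rw [inv_arcIncl, proj_arcIncl, proj_arcIncl, (R.emb v).arc_inv]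
  · rw [inv_arcMap, proj_arcMap, proj_arcMap, φ.arc_inv]

/-- The inclusion of the vertices of a substituted graph. -/
def vertIncl (v : G.V) (w : (R.graph v).V) : R.Vert := ⟨(R.emb v).vert w, v, R.mem_verts v w⟩

theorem exists_vertIncl (w : R.Vert) : ∃ v w', R.vertIncl v w' = w := by
  obtain ⟨w, v, hv⟩ := w
  have hv' := hv
  rw [← R.mk_emb] at hv'
  obtain ⟨w', rfl⟩ := hv'
  exact ⟨v, w', rfl⟩

/-- The graph substitution. -/
noncomputable def feynmanGraph : FeynmanGraph.{u} where
  A := R.Arc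
  D := R.Dart
  V := R.Vert
  finA := inferInstanceAs (Finite ({d : K.D // _} ⊕ G.bd))
  finD := inferInstanceAs (Finite {d : K.D // _})
  finV := inferInstanceAs (Finite {d : K.V // _})
  inv := R.inv
  inv_inv := R.inv_inv
  inv_ne a h := K.inv_ne (R.proj a) (by rw [← proj_inv, h])
  s := Sum.inl
  s_injective := Sum.inl_injective
  t d := ⟨K.t d.1, d.2⟩
  bd := Set.range Sum.inr
  le_bd := by
    rintro (d | b) ⟨_, h⟩
    · exact absurd ⟨d, rfl⟩ h
    · exact ⟨b, rfl⟩
  bd_le := by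
    rintro _ ⟨b, rfl⟩ ⟨d, hd⟩
    cases hd
  bd_closed := by
    rintro _ ⟨⟨b, rfl⟩, h⟩
    refine ⟨?_, ?_⟩
    · rcases hb : R.inv (Sum.inr b) with d | b'
      · exact absurd ⟨_, ⟨d, rfl⟩, by rw [← hb, R.inv_inv]⟩ h
      · exact ⟨b', rfl⟩
    · rintro ⟨_, ⟨d, rfl⟩, hd⟩
      have := congrArg R.inv hd
      rw [R.inv_inv, R.inv_inv] at this
      cases this

/-- A splitting restricts to each substitute, which is connected and so lies on one side. This
induces a splitting of `G`, trivial by its connectedness. -/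
theorem splitting_trivial (SA : Set R.Arc) (SV : Set R.Vert) (hA : ∀ a, R.inv a ∈ SA ↔ a ∈ SA)
    (hD : ∀ d : R.Dart, Sum.inl d ∈ SA ↔ (⟨K.t d.1, d.2⟩ : R.Vert) ∈ SV) :
    (SA = ∅ ∧ SV = ∅) ∨ (SA = Set.univ ∧ SV = Set.univ) := by
  have hv : ∀ v, (R.arcIncl v ⁻¹' SA = ∅ ∧ R.vertIncl v ⁻¹' SV = ∅) ∨
      (R.arcIncl v ⁻¹' SA = Set.univ ∧ R.vertIncl v ⁻¹' SV = Set.univ) := by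
    intro v
    refine (R.graph v).connected.2 _ _ (fun a => ?_) (fun c => ?_)
    · rw [Set.mem_preimage, ← inv_arcIncl]
      exact hA _
    · rw [Set.mem_preimage, arcIncl_s]
      refine (hD _).trans ?_
      have : (⟨K.t (R.dartIncl v c).1, (R.dartIncl v c).2⟩ : R.Vert) =
          R.vertIncl v ((R.graph v).t c) := Subtype.ext ((R.emb v).vert_t c).symm
      rw [this]
      rfl
  have hd : ∀ x, R.arcMap (G.s x) ∈ SA ↔
      (R.arcIncl (G.t x) ⁻¹' SA = Set.univ ∧ R.vertIncl (G.t x) ⁻¹' SV = Set.univ) := by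
    intro x
    obtain ⟨a, ha, h⟩ := R.exists_bd (v := G.t x) rfl
    rw [← hA, inv_arcMap, ← R.arcIncl_bd ha rfl h.symm]
    rcases hv (G.t x) with h1 | h1
    · refine iff_of_false (fun h2 => ?_) fun h2 => ?_
      · exact (Set.ext_iff.1 h1.1 a).1 h2
      · exact (Set.ext_iff.1 (h1.1.symm.trans h2.1) a).2 trivial
    · exact iff_of_true ((Set.ext_iff.1 h1.1 a).2 trivial) h1
  rcases G.connected.2 (R.arcMap ⁻¹' SA)
    {v | R.arcIncl v ⁻¹' SA = Set.univ ∧ R.vertIncl v ⁻¹' SV = Set.univ}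
    (fun a => by
      rw [Set.mem_preimage, ← inv_arcMap]
      exact hA _) hd with ⟨h1, h2⟩ | ⟨h1, h2⟩
  · have hv' := fun v => (hv v).resolve_right fun h => (Set.ext_iff.1 h2 v).1 h
    left
    constructor
    · refine Set.eq_empty_of_forall_notMem fun a ha => ?_
      rcases R.exists_arc a with ⟨v, a, rfl⟩ | ⟨a, rfl⟩
      · exact (Set.ext_iff.1 (hv' v).1 a).1 ha
      · exact (Set.ext_iff.1 h1 a).1 ha
    · refine Set.eq_empty_of_forall_notMem fun w hw => ?_
      obtain ⟨v, w, rfl⟩ := R.exists_vertIncl w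
      exact (Set.ext_iff.1 (hv' v).2 w).1 hw
  · have hv' := fun v => (Set.ext_iff.1 h2 v).2 trivial
    right
    constructor
    · refine Set.eq_univ_of_forall fun a => ?_
      rcases R.exists_arc a with ⟨v, a, rfl⟩ | ⟨a, rfl⟩
      · exact (Set.ext_iff.1 (hv' v).1 a).2 trivial
      · exact (Set.ext_iff.1 h1 a).2 trivial
    · refine Set.eq_univ_of_forall fun w => ?_
      obtain ⟨v, w, rfl⟩ := R.exists_vertIncl w
      exact (Set.ext_iff.1 (hv' v).2 w).2 trivial

theorem connected : R.feynmanGraph.Connected := by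
  refine ⟨?_, R.splitting_trivial⟩
  by_contra hne
  rw [not_or, not_nonempty_iff, not_nonempty_iff] at hne
  refine R.not_collapses ⟨Set.eq_empty_of_forall_notMem fun b hb => ?_, fun v => ?_⟩
  · exact hne.1.false (Sum.inr ⟨b, hb⟩)
  · have : IsEmpty (R.graph v).V := ⟨fun w => hne.2.false (R.vertIncl v w)⟩
    exact R.isEdge v

/-- The graph substitution, as a connected graph. -/
noncomputable def substitution : ConnGraph.{u} F where
  toFeynmanGraph := R.feynmanGraph
  connected := R.connected
  isOrdinary _ := by
    ext (a | a)
    · refine iff_of_false ?_ fun h => h ⟨a, rfl⟩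
      rintro ⟨b, hb⟩
      cases hb
    · refine iff_of_true ⟨a, rfl⟩ ?_
      rintro ⟨b, hb⟩
      cases hb

/-- The embedding of the graph substitution into the codomain. -/
noncomputable def projEmbedding : GraphEmbedding R.substitution K where
  arc := R.proj
  dart d := d.1
  vert w := w.1
  arc_inv := R.proj_inv
  arc_s _ := rfl
  vert_t _ := rfl
  pullback e w h := ⟨⟨e, by rw [h]; exact w.2⟩, ⟨rfl, Subtype.ext h⟩,
    fun _ hd => Subtype.ext hd.1⟩
  arc_loop := by
    rintro (a | a) h
    · exact absurd (Or.inr ⟨a, rfl⟩) h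
    · exact absurd (Or.inl ⟨a, rfl⟩) h
  vert_injective := Subtype.val_injective

/-- The embedding of a substituted graph. -/
noncomputable def incl (v : G.V) : GraphEmbedding (R.graph v) R.substitution where
  arc := R.arcIncl v
  dart := R.dartIncl v
  vert := R.vertIncl v
  arc_inv a := (R.inv_arcIncl v a).symm
  arc_s := R.arcIncl_s v
  vert_t c := Subtype.ext ((R.emb v).vert_t c)
  pullback e w h := by
    obtain ⟨c, hc, ht⟩ := (R.emb v).exists_dart (e := e.1) (w := w) (congrArg Subtype.val h)
    refine ⟨c, ⟨Subtype.ext hc, ht⟩, fun c' hc' => (R.emb v).dart_injective ?_⟩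
    rw [hc]
    exact congrArg Subtype.val hc'.1
  arc_loop a h := absurd ((R.mem_bd_or_range v a).elim Or.inl Or.inr) h
  vert_injective w w' h := (R.emb v).vert_injective (congrArg Subtype.val h)

theorem map_incl (v : G.V) : Emb.map R.projEmbedding (Emb.mk (R.incl v)) = φ.vert v := by
  rw [← R.mk_emb, Emb.map_mk]
  congr 1
  exact GraphEmbedding.ext (funext (R.proj_arcIncl v)) rfl rfl

/-- The active map to the graph substitution. -/
noncomputable def activeMap : GraphicalMap G R.substitution :=
  ofBijOn R.arcMap (fun v => Emb.mk (R.incl v)) (fun a => (R.inv_arcMap a).symm)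
    (by
      rintro v v' _ ⟨w, rfl⟩ ⟨w', h⟩
      have h' : (R.emb v').vert w' = (R.emb v).vert w := congrArg Subtype.val h
      refine φ.eq_of_mem_verts (R.mem_verts v w) ?_
      rw [← h']
      exact R.mem_verts v' w')
    (fun v => by
      refine ⟨fun x hx => ?_, fun x hx y hy h => (φ.bijOn v).injOn hx hy ?_, ?_⟩
      · obtain ⟨a, ha, h⟩ := R.exists_bd hx
        exact ⟨a, ha, R.arcIncl_bd ha hx h.symm⟩
      · have := congrArg R.proj h
        rwa [proj_arcMap, proj_arcMap] at this
      · rintro _ ⟨a, ha, rfl⟩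
        obtain ⟨x, hx, h⟩ := R.exists_dart v ha
        exact ⟨x, hx, (R.arcIncl_bd ha hx h).symm⟩)
    (fun hb he => absurd ⟨hb, fun v => by
      rw [← R.map_incl, Emb.isEdge_map]
      exact he v⟩ R.not_collapses)

theorem isActive_activeMap : R.activeMap.IsActive := by
  refine ⟨fun b hb => ⟨⟨b, hb⟩, (R.arcMap_bd ⟨b, hb⟩).symm⟩, fun b hb c hc h => ?_, ?_⟩
  · have h' : R.arcMap b = R.arcMap c := h
    rw [R.arcMap_bd ⟨b, hb⟩, R.arcMap_bd ⟨c, hc⟩] at h'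
    exact congrArg Subtype.val (Sum.inr_injective h')
  · rintro _ ⟨b, rfl⟩
    exact ⟨b.1, b.2, R.arcMap_bd b⟩

end Representatives

variable (φ : GraphicalMap G K)

/-- A factorization as an active map followed by an embedding. -/
theorem exists_factorization : ∃ (L : ConnGraph.{u} F) (g : GraphEmbedding L K)
    (α : GraphicalMap G L), α.IsActive ∧ (∀ a, g.arc (α.arc a) = φ.arc a) ∧
      ∀ v, Emb.map g (α.vert v) = φ.vert v := by
  -- If both boundaries are empty, `φ` is already active. This absorbs every case where substitution
  -- would involve a nodeless loop.
  by_cases hbd : G.bd = ∅ ∧ K.bd = ∅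
  · refine ⟨K, GraphEmbedding.id K, φ, ?_, fun _ => rfl, fun v => ?_⟩
    · rw [IsActive, hbd.1, hbd.2]
      exact Set.bijOn_empty _
    · obtain ⟨H, f, hf⟩ := (φ.vert v).exists_rep
      rw [← hf]
      rfl
  have hnc : ¬ φ.Collapses := fun h => hbd ⟨h.1, h.isNodelessLoop.1.2.2⟩
  have he : ∀ v, (φ.vert v).verts = ∅ → (φ.vert v).IsEdge := by
    intro v hv
    rw [Emb.isEdge_iff]
    refine ⟨hv, ?_⟩
    by_contra hb
    rw [Set.not_nonempty_iff_eq_empty] at hb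
    refine hbd ⟨?_, (Emb.isNodelessLoop hv hb).1.2.2⟩
    -- As φ₁(v) has empty boundary, `v` has no darts and is all of `G`.
    have hn : ∀ d, G.t d ≠ v := by
      rintro d rfl
      have := φ.arc_mem_boundary d
      rw [hb] at this
      exact this
    rcases G.connected.2 ∅ {v} (fun a => Iff.rfl)
      (fun d => iff_of_false id (hn d)) with h | h
    · exact absurd h.2 (Set.singleton_ne_empty v)
    · exact Set.eq_empty_of_forall_notMem fun b _ => (Set.ext_iff.1 h.1 b).2 trivial
  have hr := fun v => (φ.vert v).exists_rep
  choose L g hg using hr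
  let R : φ.Representatives := ⟨L, g, hg, hnc, he⟩
  exact ⟨_, R.projEmbedding, R.activeMap, R.isActive_activeMap, R.proj_arcMap, R.map_incl⟩

end GraphicalMap

/-! ### Induced subgraphs and generation by unions. -/

namespace ConnGraph

variable (H : ConnGraph.{u} F)

/-- The subgraph with a given set of vertices, all their darts, and all arcs of these darts. -/
def inducedGraph (S : Set H.V) : FeynmanGraph.{u} where
  A := {a : H.A // (∃ d, H.t d ∈ S ∧ H.s d = a) ∨ ∃ d, H.t d ∈ S ∧ H.s d = H.inv a}
  D := {d : H.D // H.t d ∈ S}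
  V := S
  finA := inferInstance
  finD := inferInstance
  finV := inferInstance
  inv a := ⟨H.inv a.1, by
    rw [H.inv_inv]
    exact a.2.symm⟩
  inv_inv a := Subtype.ext (H.inv_inv a.1)
  inv_ne a h := H.inv_ne a.1 (congrArg Subtype.val h)
  s d := ⟨H.s d.1, Or.inl ⟨d.1, d.2, rfl⟩⟩
  s_injective d e h := Subtype.ext (H.s_injective (congrArg Subtype.val h))
  t d := ⟨H.t d.1, d.2⟩
  bd := {a | ¬ ∃ d, H.t d ∈ S ∧ H.s d = a.1}
  le_bd := fun _ ha ⟨d, hd, h⟩ => ha.2 ⟨⟨d, hd⟩, Subtype.ext h⟩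
  bd_le := by
    rintro _ ha ⟨d, rfl⟩
    exact ha ⟨d.1, d.2, rfl⟩
  bd_closed := by
    rintro a ⟨ha, ha'⟩
    obtain ⟨d, hd, h⟩ := a.2.resolve_left ha
    refine absurd ⟨_, ⟨⟨d, hd⟩, rfl⟩, Subtype.ext ?_⟩ ha'
    change H.inv (H.s d) = a.1
    rw [h, H.inv_inv]

variable {H}

/-- Every arc of the induced graph belongs to a dart at `S`, so a splitting is determined by its
vertices. -/
theorem inducedGraph_connected {S : Set H.V} (hS : S.Nonempty)
    (h : ∀ (SA : Set H.A) (SV : Set H.V), (∀ a, H.inv a ∈ SA ↔ a ∈ SA) →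
      (∀ d, H.t d ∈ S → (H.s d ∈ SA ↔ H.t d ∈ SV)) → Disjoint S SV ∨ S ⊆ SV) :
    (H.inducedGraph S).Connected := by
  refine ⟨Or.inr hS.to_subtype, fun SA SV hA hD => ?_⟩
  have key : ∀ a, a ∈ SA ↔ ∃ d : (H.inducedGraph S).D, (H.s d.1 = a.1 ∨ H.s d.1 = H.inv a.1) ∧
      (H.inducedGraph S).t d ∈ SV := by
    have h1 : ∀ (a : (H.inducedGraph S).A) (d : (H.inducedGraph S).D),
        (H.s d.1 = a.1 ∨ H.s d.1 = H.inv a.1) → (a ∈ SA ↔ (H.inducedGraph S).t d ∈ SV) := by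
      rintro a d (hd | hd)
      · rw [← hD, show (H.inducedGraph S).s d = a from Subtype.ext hd]
      · rw [← hD, ← hA, show (H.inducedGraph S).s d = (H.inducedGraph S).inv a from
          Subtype.ext hd]
    intro a
    constructor
    · intro ha
      rcases a.2 with ⟨d, hd, hda⟩ | ⟨d, hd, hda⟩
      · exact ⟨⟨d, hd⟩, Or.inl hda, (h1 a ⟨d, hd⟩ (Or.inl hda)).1 ha⟩
      · exact ⟨⟨d, hd⟩, Or.inr hda, (h1 a ⟨d, hd⟩ (Or.inr hda)).1 ha⟩
    · rintro ⟨d, hd, ht⟩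
      exact (h1 a d hd).2 ht
  rcases h {a | ∃ a' ∈ SA, a'.1 = a} {v | ∃ v' ∈ SV, v'.1 = v}
    (fun a => by
      constructor
      · rintro ⟨a', ha', h'⟩
        exact ⟨(H.inducedGraph S).inv a', (hA a').2 ha', by
          change H.inv a'.1 = a
          rw [h', H.inv_inv]⟩
      · rintro ⟨a', ha', rfl⟩
        exact ⟨_, (hA a').2 ha', rfl⟩)
    (fun d hd => by
      constructor
      · rintro ⟨a', ha', h'⟩
        refine ⟨⟨H.t d, hd⟩, (hD ⟨d, hd⟩).1 ?_, rfl⟩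
        rwa [show (H.inducedGraph S).s ⟨d, hd⟩ = a' from Subtype.ext h'.symm]
      · rintro ⟨v', hv', h'⟩
        refine ⟨_, (hD ⟨d, hd⟩).2 ?_, rfl⟩
        rwa [show (H.inducedGraph S).t ⟨d, hd⟩ = v' from Subtype.ext h'.symm]) with h' | h'
  · left
    have hSV : SV = ∅ := Set.eq_empty_of_forall_notMem fun v hv =>
      Set.disjoint_left.1 h' v.2 ⟨v, hv, rfl⟩
    refine ⟨Set.eq_empty_of_forall_notMem fun a ha => ?_, hSV⟩
    obtain ⟨d, -, hd⟩ := (key a).1 ha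
    rw [hSV] at hd
    exact hd
  · right
    have hSV : SV = Set.univ := Set.eq_univ_of_forall fun v => by
      obtain ⟨v', hv', h2⟩ := h' v.2
      rwa [← Subtype.ext h2]
    refine ⟨Set.eq_univ_of_forall fun a => (key a).2 ?_, hSV⟩
    rw [hSV]
    rcases a.2 with ⟨d, hd, hda⟩ | ⟨d, hd, hda⟩
    · exact ⟨⟨d, hd⟩, Or.inl hda, trivial⟩
    · exact ⟨⟨d, hd⟩, Or.inr hda, trivial⟩

theorem disjoint_or_subset {S : Set H.V} (hS : (H.inducedGraph S).Connected)
    (SA : Set H.A) (SV : Set H.V) (hA : ∀ a, H.inv a ∈ SA ↔ a ∈ SA)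
    (hD : ∀ d, H.t d ∈ S → (H.s d ∈ SA ↔ H.t d ∈ SV)) : Disjoint S SV ∨ S ⊆ SV := by
  rcases hS.2 (Subtype.val ⁻¹' SA) (Subtype.val ⁻¹' SV) (fun a => hA a.1)
    (fun d => hD d.1 d.2) with h | h
  · exact Or.inl (Set.disjoint_left.2 fun v hv hv' => (Set.ext_iff.1 h.2 ⟨v, hv⟩).1 hv')
  · exact Or.inr fun v hv => (Set.ext_iff.1 h.2 ⟨v, hv⟩).2 trivial

theorem inducedGraph_connected_singleton (v : H.V) : (H.inducedGraph {v}).Connected := by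
  refine inducedGraph_connected (Set.singleton_nonempty v) fun SA SV _ _ => ?_
  rw [Set.disjoint_singleton_left, Set.singleton_subset_iff]
  exact (em _).symm

theorem inducedGraph_connected_insert {S : Set H.V} (hS : (H.inducedGraph S).Connected)
    {d e : H.D} (h : H.s e = H.inv (H.s d)) (hd : H.t d ∈ S) :
    (H.inducedGraph (insert (H.t e) S)).Connected := by
  refine inducedGraph_connected (Set.insert_nonempty _ _) fun SA SV hA hD => ?_
  have hde : H.t e ∈ SV ↔ H.t d ∈ SV := by
    rw [← hD e (Set.mem_insert _ _), h, hA, hD d (Set.mem_insert_of_mem _ hd)]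
  rw [Set.disjoint_insert_left, Set.insert_subset_iff, hde]
  rcases disjoint_or_subset hS SA SV hA
    (fun d hd => hD d (Set.mem_insert_of_mem _ hd)) with h' | h'
  · exact Or.inl ⟨Set.disjoint_left.1 h' hd, h'⟩
  · exact Or.inr ⟨h' hd, h'⟩

/-- A proper nonempty set of vertices has an adjacent vertex. -/
theorem exists_adjacent {S : Set H.V} (hS : S.Nonempty) (hS' : S ≠ Set.univ) :
    ∃ d e, H.s e = H.inv (H.s d) ∧ H.t d ∈ S ∧ H.t e ∉ S := by
  by_contra hcon
  push Not at hcon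
  -- If no edge left `S`, then `S` with its arcs would be a proper nonempty summand.
  rcases H.connected.2
    {a | (∃ d, H.t d ∈ S ∧ H.s d = a) ∨ ∃ d, H.t d ∈ S ∧ H.s d = H.inv a} S
    (fun a => by
      simp only [Set.mem_ofPred_eq, H.inv_inv]
      exact or_comm)
    (fun d => by
      constructor
      · rintro (⟨e, he, h⟩ | ⟨e, he, h⟩)
        · rwa [← H.s_injective h]
        · exact hcon e d (by rw [h, H.inv_inv]) he
      · exact fun h => Or.inl ⟨d, h, rfl⟩) with h | h
  · exact hS.ne_empty h.2
  · exact hS' h.2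

/-- The induced subgraph, as a connected graph. -/
def induced {S : Set H.V} (hS : (H.inducedGraph S).Connected) : ConnGraph.{u} F where
  toFeynmanGraph := H.inducedGraph S
  connected := hS
  isOrdinary _ := by
    ext a
    refine not_congr ⟨?_, ?_⟩
    · rintro ⟨d, hd, h⟩
      exact ⟨⟨d, hd⟩, Subtype.ext h⟩
    · rintro ⟨d, rfl⟩
      exact ⟨d.1, d.2, rfl⟩

/-- The embedding of the induced subgraph. -/
def inducedEmbedding {S : Set H.V} (hS : (H.inducedGraph S).Connected) :
    GraphEmbedding (induced hS) H where
  arc := Subtype.val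
  dart := Subtype.val
  vert := Subtype.val
  arc_inv _ := rfl
  arc_s _ := rfl
  vert_t _ := rfl
  pullback e w h := ⟨⟨e, by rw [h]; exact w.2⟩, ⟨rfl, Subtype.ext h⟩,
    fun _ hd => Subtype.ext hd.1⟩
  arc_loop a h := absurd (by
    by_cases ha : ∃ d, H.t d ∈ S ∧ H.s d = a.1
    · obtain ⟨d, hd, h'⟩ := ha
      exact Or.inr ⟨⟨d, hd⟩, Subtype.ext h'⟩
    · exact Or.inl ha) h
  vert_injective := Subtype.val_injective

end ConnGraph

namespace Emb

variable {G H : ConnGraph.{u} F}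

theorem induced_le {S T : Set H.V} (hS : (H.inducedGraph S).Connected)
    (hT : (H.inducedGraph T).Connected) (hne : S.Nonempty) (h : S ⊆ T) (f : GraphEmbedding H G) :
    mk ((ConnGraph.inducedEmbedding hS).comp f) ≤ mk ((ConnGraph.inducedEmbedding hT).comp f) := by
  have : Nonempty (ConnGraph.induced hS).V := hne.to_subtype
  obtain ⟨z, hz⟩ := (ConnGraph.inducedEmbedding hS).exists_lift (ConnGraph.inducedEmbedding hT)
    (by
      rintro _ ⟨v, rfl⟩
      exact ⟨⟨v.1, h v.2⟩, rfl⟩)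
    (by
      rintro d ⟨a, ha, h'⟩ ⟨e, he, h2⟩
      exact ha ⟨e, h he, h2.trans h'.symm⟩)
  refine mk_le_mk.2 ⟨z, ?_⟩
  change (z.comp (ConnGraph.inducedEmbedding hT).toEtaleMap).comp f.toEtaleMap = _
  rw [hz]
  rfl

theorem induced_le_self {S : Set H.V} (hS : (H.inducedGraph S).Connected)
    (f : GraphEmbedding H G) : mk ((ConnGraph.inducedEmbedding hS).comp f) ≤ mk f :=
  mk_le_mk.2 ⟨(ConnGraph.inducedEmbedding hS).toEtaleMap, rfl⟩

theorem verts_induced {S : Set H.V} (hS : (H.inducedGraph S).Connected)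
    (f : GraphEmbedding H G) :
    (mk ((ConnGraph.inducedEmbedding hS).comp f)).verts = f.vert '' S := by
  ext w
  constructor
  · rintro ⟨v, rfl⟩
    exact ⟨v.1, v.2, rfl⟩
  · rintro ⟨v, hv, rfl⟩
    exact ⟨⟨v, hv⟩, rfl⟩

/-- All classes of embeddings arise from edges and stars by taking unions. -/
theorem union_induction {P : Emb G → Prop} (hedge : ∀ x, x.IsEdge → P x)
    (hstar : ∀ v, P (mk (GraphEmbedding.star G v)))
    (hunion : ∀ l h k, IsUnion l h k → P h → P k → P l) (x : Emb G) : P x := by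
  obtain ⟨H, f, rfl⟩ := x.exists_rep
  rcases isEmpty_or_nonempty H.V with hV | ⟨⟨v⟩⟩
  -- A nodeless loop is a union of an edge with itself, as unions constrain only the order and the
  -- vertices.
  · obtain ⟨a⟩ := H.nonempty_A
    let e := mk ((GraphEmbedding.edge H a).comp f)
    have hle : e ≤ mk f := mk_le_mk.2 ⟨(GraphEmbedding.edge H a).toEtaleMap, rfl⟩
    have he : e.IsEdge := isEdge_iff.2 ⟨verts_eq_empty_iff.2 (inferInstanceAs (IsEmpty PEmpty)),
      ⟨_, ⟨true⟩, trivial, rfl⟩⟩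
    refine hunion _ e e ⟨hle, hle, ?_⟩ (hedge e he) (hedge e he)
    rw [verts_eq_empty_iff.2 hV, (isEdge_iff.1 he).1, Set.union_self]
  -- A maximal good set of vertices is everything, since an adjacent vertex could be added by a
  -- union with its star.
  · let good : Set (Set H.V) := {S | S.Nonempty ∧ ∃ hS : (H.inducedGraph S).Connected,
      P (mk ((ConnGraph.inducedEmbedding hS).comp f))}
    have hgood : good.Nonempty := by
      refine ⟨{v}, Set.singleton_nonempty v, ConnGraph.inducedGraph_connected_singleton v, ?_⟩
      have hle := star_le (v := f.vert v)
        (x := mk ((ConnGraph.inducedEmbedding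
          (ConnGraph.inducedGraph_connected_singleton v)).comp f)) (by
        rw [verts_induced]
        exact ⟨v, rfl, rfl⟩)
      -- The star cuts loops at `v` which the induced graph keeps; a union of the star with itself
      -- bridges this.
      refine hunion _ _ _ ⟨hle, hle, ?_⟩ (hstar (f.vert v)) (hstar (f.vert v))
      rw [verts_induced, verts_star, Set.union_self, Set.image_singleton]
    obtain ⟨S, ⟨hne, hS, hP⟩, hmax⟩ := (Set.toFinite good).exists_maximal hgood
    by_cases hu : S = Set.univ
    · refine hunion _ _ _ ⟨induced_le_self hS f, induced_le_self hS f, ?_⟩ hP hP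
      rw [verts_induced, Set.union_self, hu, Set.image_univ]
      rfl
    · exfalso
      obtain ⟨d, e, h, hd, he⟩ := ConnGraph.exists_adjacent hne hu
      have hS' := ConnGraph.inducedGraph_connected_insert hS h hd
      refine he (hmax (y := insert (H.t e) S) ⟨Set.insert_nonempty _ _, hS', ?_⟩
        (Set.subset_insert _ _) (Set.mem_insert _ _))
      refine hunion _ _ _ ⟨induced_le hS hS' hne (Set.subset_insert _ _) f,
        star_le (v := f.vert (H.t e)) ?_, ?_⟩ hP (hstar _)
      · rw [verts_induced]
        exact ⟨_, Set.mem_insert _ _, rfl⟩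
      · rw [verts_induced, verts_induced, verts_star, Set.image_insert_eq, Set.union_comm,
          Set.singleton_union]

end Emb

namespace Emb

variable {G K H : ConnGraph.{u} F}

theorem map_comp (f : GraphEmbedding H G) (g : GraphEmbedding G K) (x : Emb H) :
    map (f.comp g) x = map g (map f x) := by
  obtain ⟨L, e, rfl⟩ := x.exists_rep
  rfl

end Emb

/-! ### The image of a class under a graphical map. -/

namespace GraphicalMap

variable {G K L : ConnGraph.{u} F} (φ : GraphicalMap G K)

theorem bijOn_of_isImage {x : Emb G} {y : Emb K} (h : φ.IsImage x y) :
    Set.BijOn φ.arc x.boundary y.boundary := by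
  obtain ⟨H, L, f, g, rfl, rfl, α, hα, ha, -⟩ := h
  refine ⟨?_, ?_, ?_⟩
  · rintro _ ⟨b, hb, rfl⟩
    exact ⟨_, hα.mapsTo hb, ha b⟩
  · rintro _ ⟨b, hb, rfl⟩ _ ⟨c, hc, rfl⟩ h
    rw [← ha, ← ha] at h
    rw [hα.injOn hb hc (g.arc_bd_injOn (hα.mapsTo hb) (hα.mapsTo hc) h)]
  · rintro _ ⟨b, hb, rfl⟩
    obtain ⟨c, hc, rfl⟩ := hα.surjOn hb
    exact ⟨f.arc c, ⟨c, hc, rfl⟩, (ha c).symm⟩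

theorem mem_verts_of_isImage {x : Emb G} {y : Emb K} (h : φ.IsImage x y) (w : K.V) :
    w ∈ y.verts ↔ ∃ v ∈ x.verts, w ∈ (φ.vert v).verts := by
  obtain ⟨H, L, f, g, rfl, rfl, α, hα, -, hv⟩ := h
  constructor
  · rintro ⟨w, rfl⟩
    obtain ⟨v, h⟩ := hα.exists_mem_verts w
    refine ⟨f.vert v, ⟨v, rfl⟩, ?_⟩
    rw [← hv, Emb.verts_map]
    exact ⟨w, h, rfl⟩
  · rintro ⟨_, ⟨v, rfl⟩, h⟩
    rw [← hv, Emb.verts_map] at h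
    obtain ⟨w, -, rfl⟩ := h
    exact ⟨w, rfl⟩

theorem exists_isImage (x : Emb G) : ∃ y, φ.IsImage x y := by
  obtain ⟨H, f, rfl⟩ := x.exists_rep
  obtain ⟨L, g, α, h⟩ := (φ.precomp f).exists_factorization
  exact ⟨_, H, L, f, g, rfl, rfl, α, h⟩

theorem eq_of_isImage {x : Emb G} {y : Emb K} (h : φ.IsImage x y) {y' : Emb K}
    (hv : ∀ w, w ∈ y'.verts ↔ ∃ v ∈ x.verts, w ∈ (φ.vert v).verts)
    (hb : y'.boundary = φ.arc '' x.boundary) : y' = y :=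
  Emb.ext (Set.ext fun w => (hv w).trans (φ.mem_verts_of_isImage h w).symm)
    (hb.trans (φ.bijOn_of_isImage h).image_eq)

theorem IsImage.unique {φ : GraphicalMap G K} {x : Emb G} {y y' : Emb K} (h : φ.IsImage x y)
    (h' : φ.IsImage x y') : y = y' :=
  φ.eq_of_isImage h' (φ.mem_verts_of_isImage h) (φ.bijOn_of_isImage h).image_eq.symm

theorem IsImage.mono {φ : GraphicalMap G K} {x x' : Emb G} {y y' : Emb K} (h : φ.IsImage x y)
    (h' : φ.IsImage x' y') (hx : x ≤ x') : y ≤ y' := by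
  obtain ⟨H, f, rfl⟩ := x.exists_rep
  obtain ⟨H', L, f', g, rfl, rfl, α, hα, ha, hv⟩ := h'
  obtain ⟨z, hz⟩ := Emb.mk_le_mk.1 hx
  have hzv : ∀ v, f'.vert (z.vert v) = f.vert v := congrFun (congrArg EtaleMap.vert hz)
  have hza : ∀ a, f'.arc (z.arc a) = f.arc a := congrFun (congrArg EtaleMap.arc hz)
  let z' : GraphEmbedding H H' :=
    ⟨z, fun v w hvw => f.vert_injective (by rw [← hzv, hvw, hzv])⟩
  -- Factoring the restriction of `α` gives a factorization of `φ ∘ f` whose embedding passes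
  -- through `g`; uniqueness identifies it with `y`.
  obtain ⟨L', g', α', hα', ha', hv'⟩ := (α.precomp z').exists_factorization
  have himage : φ.IsImage (Emb.mk f) (Emb.mk (g'.comp g)) := by
    refine ⟨H, L', f, g'.comp g, rfl, rfl, α', hα', fun a => ?_, fun v => ?_⟩
    · rw [← hza, ← ha]
      exact congrArg g.arc (ha' a)
    · rw [Emb.map_comp, hv', ← hzv, ← hv]
      rfl
  rw [h.unique himage]
  exact Emb.mk_le_mk.2 ⟨g'.toEtaleMap, rfl⟩

/-- The class of the embedding in an active-inert factorization. -/
noncomputable def image (x : Emb G) : Emb K := (φ.exists_isImage x).choose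

theorem isImage_image (x : Emb G) : φ.IsImage x (φ.image x) := (φ.exists_isImage x).choose_spec

theorem image_eq_iff {x : Emb G} {y : Emb K} : φ.image x = y ↔ φ.IsImage x y :=
  ⟨fun h => h ▸ φ.isImage_image x, fun h => (φ.isImage_image x).unique h⟩

theorem mem_verts_image (x : Emb G) (w : K.V) :
    w ∈ (φ.image x).verts ↔ ∃ v ∈ x.verts, w ∈ (φ.vert v).verts :=
  φ.mem_verts_of_isImage (φ.isImage_image x) w

theorem bijOn_image (x : Emb G) : Set.BijOn φ.arc x.boundary (φ.image x).boundary :=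
  φ.bijOn_of_isImage (φ.isImage_image x)

theorem image_star (v : G.V) : φ.image (Emb.mk (GraphEmbedding.star G v)) = φ.vert v := by
  refine (φ.eq_of_isImage (φ.isImage_image _) (fun w => ?_) ?_).symm
  · simp [-Emb.verts_mk, Emb.verts_star]
  · rw [Emb.boundary_star, Set.image_image]
    exact (φ.bijOn v).image_eq.symm

/-- The new graph map of a graphical map. -/
noncomputable def toNewGraphMap : NewGraphMap G K where
  arc := φ.arc
  hat := φ.image
  arc_inv := φ.arc_inv
  hat_edge x hx := by
    obtain ⟨hv, hb⟩ := Emb.isEdge_iff.1 hx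
    refine Emb.isEdge_iff.2 ⟨Set.eq_empty_of_forall_notMem fun w hw => ?_, ?_⟩
    · obtain ⟨v, h, -⟩ := (φ.mem_verts_image x w).1 hw
      rw [hv] at h
      exact h
    · rw [← (φ.bijOn_image x).image_eq]
      exact hb.image _
  hat_union l h k hu := by
    refine ⟨(φ.isImage_image h).mono (φ.isImage_image l) hu.1,
      (φ.isImage_image k).mono (φ.isImage_image l) hu.2.1, ?_⟩
    ext w
    simp only [Set.mem_union, mem_verts_image, hu.2.2, or_and_right, exists_or]
  hat_disjoint h k hd := by
    refine Set.eq_empty_of_forall_notMem fun w ⟨hw, hw'⟩ => ?_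
    obtain ⟨v, hv, h1⟩ := (φ.mem_verts_image h w).1 hw
    obtain ⟨v', hv', h2⟩ := (φ.mem_verts_image k w).1 hw'
    obtain rfl := φ.eq_of_mem_verts h1 h2
    exact (Set.ext_iff.1 hd v).1 ⟨hv, hv'⟩
  hat_boundary h := Emb.sumOf_eq_map_iff.2 (φ.bijOn_image h)

end GraphicalMap

/-! ### The inverse bijection and the transported category. -/

namespace NewGraphMap

variable {G K : ConnGraph.{u} F} (ν : NewGraphMap G K)

theorem bijOn (x : Emb G) : Set.BijOn ν.arc x.boundary (ν.hat x).boundary :=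
  Emb.sumOf_eq_map_iff.1 (ν.hat_boundary x)

/-- Both sides turn unions of classes into unions of vertex sets, so edges and stars suffice. -/
theorem mem_verts_hat (x : Emb G) : ∀ w, w ∈ (ν.hat x).verts ↔
    ∃ v ∈ x.verts, w ∈ (ν.hat (Emb.mk (GraphEmbedding.star G v))).verts := by
  induction x using Emb.union_induction with
  | hedge x hx =>
    intro w
    rw [(Emb.isEdge_iff.1 hx).1, (Emb.isEdge_iff.1 (ν.hat_edge x hx)).1]
    simp
  | hstar v =>
    intro w
    simp [-Emb.verts_mk, Emb.verts_star]
  | hunion l h k hu hh hk =>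
    intro w
    rw [(ν.hat_union l h k hu).2.2, hu.2.2]
    simp only [Set.mem_union, hh, hk, or_and_right, exists_or]

/-- The graphical map of a new graph map. -/
noncomputable def toGraphicalMap : GraphicalMap G K :=
  .ofBijOn ν.arc (fun v => ν.hat (Emb.mk (GraphEmbedding.star G v))) ν.arc_inv
    (by
      intro v v' w h h'
      by_contra hne
      refine (Set.ext_iff.1 (ν.hat_disjoint _ _ ?_) w).1 ⟨h, h'⟩
      rw [Emb.VertexDisjoint, Emb.verts_star, Emb.verts_star, Set.singleton_inter_eq_empty]
      exact hne)
    (fun v => by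
      have h := ν.bijOn (Emb.mk (GraphEmbedding.star G v))
      rw [Emb.boundary_star] at h
      refine h.comp ⟨Set.mapsTo_image _ _, ?_, Set.surjOn_image _ _⟩
      exact fun d _ e _ hde => G.s_injective (G.inv_injective hde))
    (by
      intro hb he
      have hb' : (Emb.mk (GraphEmbedding.id G)).boundary = ∅ := by
        rw [Emb.boundary_mk, hb, Set.image_empty]
      -- In the collapse case the image of the whole of `G` has neither vertices nor boundary, which
      -- forces `K` to be a nodeless loop.
      refine Emb.isNodelessLoop (x := ν.hat (Emb.mk (GraphEmbedding.id G))) ?_ ?_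
      · refine Set.eq_empty_of_forall_notMem fun w hw => ?_
        obtain ⟨v, -, hv⟩ := (ν.mem_verts_hat _ w).1 hw
        rw [(Emb.isEdge_iff.1 (he v)).1] at hv
        exact hv
      · rw [← (ν.bijOn _).image_eq, hb', Set.image_empty])

end NewGraphMap

/-- Graphical maps correspond to new graph maps. -/
noncomputable def graphicalEquivNew (G K : ConnGraph.{u} F) :
    GraphicalMap G K ≃ NewGraphMap G K where
  toFun := GraphicalMap.toNewGraphMap
  invFun := NewGraphMap.toGraphicalMap
  left_inv φ := GraphicalMap.ext rfl (funext φ.image_star)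
  right_inv ν := NewGraphMap.ext rfl (funext fun x =>
    (ν.toGraphicalMap.eq_of_isImage (ν.toGraphicalMap.isImage_image x) (ν.mem_verts_hat x)
      (ν.bijOn x).image_eq.symm).symm)

/-- The category of graphical maps. -/
noncomputable def graphicalCategory (F : Flavor) :
    HomCategory (fun G K : ConnGraph.{u} F => GraphicalMap G K) where
  id G := (graphicalEquivNew G G).symm ((newGraphCategory F).id G)
  comp φ ψ := (graphicalEquivNew _ _).symm
    ((newGraphCategory F).comp (graphicalEquivNew _ _ φ) (graphicalEquivNew _ _ ψ))
  id_comp φ := by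
    rw [Equiv.apply_symm_apply, (newGraphCategory F).id_comp, Equiv.symm_apply_apply]
  comp_id φ := by
    rw [Equiv.apply_symm_apply, (newGraphCategory F).comp_id, Equiv.symm_apply_apply]
  assoc φ ψ χ := by
    rw [Equiv.apply_symm_apply, Equiv.apply_symm_apply, (newGraphCategory F).assoc]

end ModularGraph

/-- `F = Flavor.ordinary` is the statement for the graphical category `U` (connected graphs without
nodeless loops), and `F = Flavor.extended` the statement for the extended graphical category
(nodeless loops included). -/
theorem theoremA (F : Flavor) :
    ∃ U : HomCategory (fun G K : ConnGraph.{u} F => GraphicalMap G K),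
      (∀ G, (U.id G).IsIdentity) ∧
      (∀ {G K L : ConnGraph.{u} F} (φ : GraphicalMap G K) (ψ : GraphicalMap K L)
        (χ : GraphicalMap G L), χ = U.comp φ ψ ↔ φ.IsComposite ψ χ) ∧
      ∃ N : ∀ G K : ConnGraph.{u} F, GraphicalMap G K ≃ NewGraphMap G K,
        (∀ {G K : ConnGraph.{u} F} (φ : GraphicalMap G K),
          (N G K φ).arc = φ.arc ∧
          ∀ (x : Emb G) (y : Emb K), (N G K φ).hat x = y ↔ φ.IsImage x y) ∧
        (∀ {G K : ConnGraph.{u} F} (ν : NewGraphMap G K),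
          ((N G K).symm ν).arc = ν.arc ∧
          ∀ v, ((N G K).symm ν).vert v = ν.hat (Emb.mk (GraphEmbedding.star G v))) ∧
        (∀ G, N G G (U.id G) = (newGraphCategory F).id G) ∧
        (∀ {G K L : ConnGraph.{u} F} (φ : GraphicalMap G K) (ψ : GraphicalMap K L),
          N G L (U.comp φ ψ) = (newGraphCategory F).comp (N G K φ) (N K L ψ)) := by
  refine ⟨graphicalCategory F, fun G => ⟨fun _ => rfl, fun _ => rfl⟩, fun φ ψ χ => ?_,
    graphicalEquivNew, fun φ => ⟨rfl, fun x y => φ.image_eq_iff⟩, fun ν => ⟨rfl, fun _ => rfl⟩,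
    fun G => Equiv.apply_symm_apply _ _, fun φ ψ => Equiv.apply_symm_apply _ _⟩
  -- The transported composite is evaluated on the star of `v`, whose image under `φ` is φ₁(v).
  have hv : ∀ v, ((graphicalCategory F).comp φ ψ).vert v = ψ.image (φ.vert v) := fun v =>
    congrArg ψ.image (φ.image_star v)
  constructor
  · rintro rfl
    exact ⟨fun _ => rfl, fun v => ψ.image_eq_iff.1 (hv v).symm⟩
  · rintro ⟨ha, hχ⟩
    exact GraphicalMap.ext (funext ha)
      (funext fun v => (ψ.image_eq_iff.2 (hχ v)).symm.trans (hv v).symm)
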